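/- Let $n \ge 5$, let $L = A_n$ be the alternating group on $n$ letters, let $r \le n$ be an odd prime, and let $x \in \mathrm{Aut}(L)$ be an automorphism of prime order. Identify $S_n$ with its image in $\mathrm{Aut}(L)$ under conjugation. Let $\beta_r(x,L)$ denote the minimal number of $L$-conjugates of $x$ (that is, conjugates of $x$ in $\mathrm{Aut}(L)$ by inner automorphisms of $L$) which generate a subgroup of order divisible by $r$. Then: (1) if $x$ is a transposition, then $\beta_r(x,L) = r-1$; (2) if $r = 3$, $n = 6$ and $x$ is an involution not lying in $S_6$, then $\beta_3(x,L) = 3$; (3) in all other cases, $\beta_r(x,L) \le r-1$. -/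

import Mathlib

/-- The tuple `y 0, …, y (m - 1)` consists of conjugates of the automorphism `x` of `L` by
inner automorphisms of `L`, and these conjugates generate a subgroup of `Aut L` whose order is
divisible by `r`. -/
def GeneratesOrderDivisible (r : ℕ) {L : Type*} [Group L] (x : MulAut L) {m : ℕ}
    (y : Fin m → MulAut L) : Prop :=
  (∀ i, ∃ g : L, y i = MulAut.conj g * x * (MulAut.conj g)⁻¹) ∧
    r ∣ Nat.card (Subgroup.closure (Set.range y))

/-- For an automorphism `x` of a finite group `L`, the minimal number of `L`-conjugates of `x`
which generate a subgroup of order divisible by `r`. It takes values in `ℕ∞`, and equals `⊤` if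
no number of `L`-conjugates of `x` generates such a subgroup. -/
noncomputable def betaNumber (r : ℕ) {L : Type*} [Group L] (x : MulAut L) : ℕ∞ :=
  ⨅ (m : ℕ) (_ : ∃ y : Fin m → MulAut L, GeneratesOrderDivisible r x y), (m : ℕ∞)

/-- The homomorphism from the symmetric group on `n` letters to the automorphism group of the
alternating group on `n` letters, given by conjugation. -/
def symmetricToAut (n : ℕ) : Equiv.Perm (Fin n) →* MulAut (alternatingGroup (Fin n)) :=
  MulAut.conjNormal

/-- The automorphism `x` of the alternating group is (conjugation by) a transposition. -/
def IsTranspositionAut {n : ℕ} (x : MulAut (alternatingGroup (Fin n))) : Prop :=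
  ∃ σ : Equiv.Perm (Fin n), σ.IsSwap ∧ symmetricToAut n σ = x

/-- The automorphism `x` of the alternating group is an involution which is not induced by
conjugation by an element of the symmetric group. -/
def IsInvolutionOutsideSymmetric {n : ℕ} (x : MulAut (alternatingGroup (Fin n))) : Prop :=
  orderOf x = 2 ∧ x ∉ (symmetricToAut n).range

/-! For `x` induced by a permutation `σ`, the upper bound comes from exhibiting an element of order
`r` as a word in `r - 1` conjugates of `σ` by even permutations. Costs add under products, and a
commutator of `σ` with an even permutation costs two. Usually such a commutator can be made a
3-cycle, and each 3-cycle lengthens a cycle by two letters, so an `r`-cycle costs `r - 1`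
(`HasCycleInConjClosure.of_three`). The exceptions are products of several 3-cycles and
fixed-point-free involutions. There 5-cycles of cost 4 do the lengthening, starting from length 5 or
7 (`of_five_seven`).

For a transposition the bound is sharp: `m` transpositions have at least `n - m` orbits, while an
element of order `r` has an orbit of size `r` (`prime_le_of_mem_closure_isSwap`).

For `n ≠ 6` every automorphism is induced by a permutation. Products of two 3-cycles have order
dividing 60, which separates 3-cycles from the other elements of order three, and an automorphism
preserving 3-cycles is determined by arcs that their images share.

For `n = 6` an outer automorphism of prime order is an involution exchanging 3-cycles with products
of two 3-cycles. Hence it inverts no element of order three. Two conjugates of it generate a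
dihedral group whose elements of order three would be inverted, so `r = 3` needs a third conjugate.
Explicit words in a 3-cycle and its image give order five with two conjugates and order three with
three. -/

open Equiv Equiv.Perm

/-! ### Counting the conjugates that a word uses -/

section ConjClosure

variable {G H : Type*} [Group G] [Group H]

/-- `t` lies in the subgroup generated by some `m` conjugates of `x` by elements of `N`. -/
def MemConjClosure (N : Subgroup G) (x : G) (m : ℕ) (t : G) : Prop :=
  ∃ y : Fin m → G, (∀ i, ∃ g ∈ N, y i = g * x * g⁻¹) ∧ t ∈ Subgroup.closure (Set.range y)

namespace MemConjClosure

variable {N : Subgroup G} {x s t : G} {l m : ℕ}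

theorem one (N : Subgroup G) (x : G) (m : ℕ) : MemConjClosure N x m 1 :=
  ⟨fun _ => x, fun _ => ⟨1, N.one_mem, by simp⟩, one_mem _⟩

theorem conj_self {g : G} (hg : g ∈ N) : MemConjClosure N x 1 (g * x * g⁻¹) :=
  ⟨fun _ => g * x * g⁻¹, fun _ => ⟨g, hg, rfl⟩, Subgroup.subset_closure ⟨0, rfl⟩⟩

theorem self (N : Subgroup G) (x : G) : MemConjClosure N x 1 x := by
  simpa using conj_self (x := x) N.one_mem

theorem inv (h : MemConjClosure N x m t) : MemConjClosure N x m t⁻¹ := by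
  obtain ⟨y, hy, ht⟩ := h
  exact ⟨y, hy, inv_mem ht⟩

theorem mul (hs : MemConjClosure N x l s) (ht : MemConjClosure N x m t) :
    MemConjClosure N x (l + m) (s * t) := by
  obtain ⟨y, hy, hs⟩ := hs
  obtain ⟨z, hz, ht⟩ := ht
  refine ⟨Fin.append y z, fun i => ?_, mul_mem ?_ ?_⟩
  · induction i using Fin.addCases with
    | left i => simpa using hy i
    | right i => simpa using hz i
  · refine Subgroup.closure_mono ?_ hs
    rintro _ ⟨i, rfl⟩
    exact ⟨Fin.castAdd m i, by simp⟩
  · refine Subgroup.closure_mono ?_ ht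
    rintro _ ⟨i, rfl⟩
    exact ⟨Fin.natAdd l i, by simp⟩

theorem mono (h : MemConjClosure N x l t) (hlm : l ≤ m) : MemConjClosure N x m t := by
  simpa [Nat.add_sub_cancel' hlm] using h.mul (one N x (m - l))

theorem conj (h : MemConjClosure N x m t) {g : G} (hg : g ∈ N) :
    MemConjClosure N x m (g * t * g⁻¹) := by
  obtain ⟨y, hy, ht⟩ := h
  refine ⟨fun i => g * y i * g⁻¹, fun i => ?_, ?_⟩
  · obtain ⟨k, hk, e⟩ := hy i
    exact ⟨g * k, mul_mem hg hk, by simp only [e]; group⟩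
  · have := Subgroup.mem_map_of_mem (MulAut.conj g).toMonoidHom ht
    rw [MonoidHom.map_closure, ← Set.range_comp] at this
    exact this

/-- The element is the commutator of `t` and `g`: any `g ∈ N` may be used, and it is not itself
charged for. -/
theorem mul_conj_inv (h : MemConjClosure N x m t) {g : G} (hg : g ∈ N) :
    MemConjClosure N x (2 * m) (t * (g * t * g⁻¹)⁻¹) := by
  rw [two_mul]
  exact h.mul (h.conj hg).inv

theorem map (f : G →* H) (h : MemConjClosure N x m t) :
    MemConjClosure (N.map f) (f x) m (f t) := by
  obtain ⟨y, hy, ht⟩ := h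
  refine ⟨fun i => f (y i), fun i => ?_, ?_⟩
  · obtain ⟨g, hg, e⟩ := hy i
    exact ⟨f g, Subgroup.mem_map_of_mem f hg, by simp [e]⟩
  · have := Subgroup.mem_map_of_mem f ht
    rwa [MonoidHom.map_closure, ← Set.range_comp] at this

end MemConjClosure

theorem dvd_card_of_mem_of_pow_eq_one [Finite G] {r : ℕ} (hr : r.Prime) {K : Subgroup G} {t : G}
    (ht : t ∈ K) (h1 : t ^ r = 1) (hne : t ≠ 1) : r ∣ Nat.card K := by
  have := Fact.mk hr
  rw [← orderOf_eq_prime h1 hne, ← Subgroup.orderOf_mk t ht]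
  exact orderOf_dvd_natCard _

theorem betaNumber_le_of_memConjClosure {L : Type*} [Group L] [Finite L] {r m : ℕ} (hr : r.Prime)
    {x t : MulAut L} (h : MemConjClosure (MulAut.conj (G := L)).range x m t) (h1 : t ^ r = 1)
    (hne : t ≠ 1) : betaNumber r x ≤ m := by
  obtain ⟨y, hy, ht⟩ := h
  have : Finite (MulAut L) := Finite.of_injective (fun f : MulAut L => (f : L → L))
    DFunLike.coe_injective
  refine iInf₂_le m ⟨y, fun i => ?_, dvd_card_of_mem_of_pow_eq_one hr ht h1 hne⟩
  obtain ⟨_, ⟨g, rfl⟩, e⟩ := hy i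
  exact ⟨g, e⟩

end ConjClosure

/-! ### The symmetric group inside the automorphism group -/

theorem symmetricToAut_coe {n : ℕ} (g : alternatingGroup (Fin n)) :
    symmetricToAut n g = MulAut.conj g :=
  MulAut.conjNormal_val

theorem coe_symmetricToAut_apply {n : ℕ} (σ : Perm (Fin n)) (g : alternatingGroup (Fin n)) :
    (symmetricToAut n σ g : Perm (Fin n)) = σ * g * σ⁻¹ :=
  MulAut.conjNormal_apply σ g

theorem map_symmetricToAut_alternatingGroup (n : ℕ) :
    (alternatingGroup (Fin n)).map (symmetricToAut n) = (MulAut.conj).range := by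
  ext f
  constructor
  · rintro ⟨g, hg, rfl⟩
    exact ⟨⟨g, hg⟩, (symmetricToAut_coe ⟨g, hg⟩).symm⟩
  · rintro ⟨g, rfl⟩
    exact ⟨g, g.2, symmetricToAut_coe g⟩

theorem isThreeCycle_formPerm {α : Type*} [Fintype α] [DecidableEq α] {a b c : α}
    (h : [a, b, c].Nodup) : (List.formPerm [a, b, c]).IsThreeCycle := by
  rw [← card_support_eq_three_iff, List.support_formPerm_of_nodup _ h (by simp),
    List.toFinset_card_of_nodup h]
  rfl

theorem symmetricToAut_injective {n : ℕ} (hn : 4 ≤ n) : Function.Injective (symmetricToAut n) := by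
  rw [injective_iff_map_eq_one]
  intro σ hσ
  ext1 a
  by_contra hne
  simp only [Perm.coe_one, id_eq] at hne
  -- If `σ` commutes with the 3-cycle `(a, σ a, b)`, evaluating at `σ a` gives `b = σ (σ a)`; so `b`
  -- is chosen to avoid that value.
  obtain ⟨b, hb⟩ : ∃ b, b ∉ ({a, σ a, σ (σ a)} : Finset (Fin n)) := by
    by_contra! hall
    have h1 := Finset.card_le_card (show Finset.univ ⊆ ({a, σ a, σ (σ a)} : Finset (Fin n)) from
      fun b _ => hall b)
    have h2 := Finset.card_le_three (a := a) (b := σ a) (c := σ (σ a))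
    simp at h1
    omega
  simp only [Finset.mem_insert, Finset.mem_singleton, not_or] at hb
  have hnd : [a, σ a, b].Nodup := by grind
  have h := coe_symmetricToAut_apply σ ⟨_, (isThreeCycle_formPerm hnd).mem_alternatingGroup⟩
  rw [hσ] at h
  have h2 := congrArg (fun f : Perm (Fin n) => f (σ a)) h
  have e1 : List.formPerm [a, σ a, b] (σ a) = b := by
    simp [List.formPerm_cons_cons, Equiv.swap_apply_of_ne_of_ne, hb.1, hb.2.1]
  have e2 : List.formPerm [a, σ a, b] a = σ a := List.formPerm_apply_head _ _ _ hnd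
  have e3 : σ⁻¹ (σ a) = a := by simp
  simp only [MulAut.one_apply, Perm.mul_apply, e3, e1, e2] at h2
  exact hb.2.2 h2

theorem betaNumber_symmetricToAut_le {n r m : ℕ} (hn : 4 ≤ n) (hr : r.Prime) {σ t : Perm (Fin n)}
    (h : MemConjClosure (alternatingGroup (Fin n)) σ m t) (h1 : t ^ r = 1) (hne : t ≠ 1) :
    betaNumber r (symmetricToAut n σ) ≤ m := by
  have h' := h.map (symmetricToAut n)
  rw [map_symmetricToAut_alternatingGroup] at h'
  refine betaNumber_le_of_memConjClosure hr h' (by rw [← map_pow, h1, map_one]) fun he => hne ?_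
  exact symmetricToAut_injective hn (he.trans (map_one _).symm)

/-! ### Commutators with cycles, computed on a few letters -/

section Transport

variable {α β : Type*} [DecidableEq α] [DecidableEq β]

theorem mul_formPerm_mul_inv (σ : Perm α) (l : List α) :
    σ * l.formPerm * σ⁻¹ = (l.map σ).formPerm := by
  induction l with
  | nil => simp
  | cons a l ih =>
    cases l with
    | nil => simp
    | cons b l =>
      simp only [List.map_cons, List.formPerm_cons_cons] at ih ⊢
      rw [← ih, Equiv.swap_apply_apply]
      group

theorem viaEmbeddingHom_swap (e : α ↪ β) (a b : α) :
    viaEmbeddingHom e (swap a b) = swap (e a) (e b) := by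
  ext z
  rw [viaEmbeddingHom_apply]
  by_cases hz : z ∈ Set.range e
  · obtain ⟨c, rfl⟩ := hz
    rw [viaEmbedding_apply]
    simp only [swap_apply_def, e.injective.eq_iff]
    split_ifs <;> rfl
  · rw [viaEmbedding_apply_of_notMem _ _ _ hz, swap_apply_of_ne_of_ne]
    · rintro rfl; exact hz ⟨a, rfl⟩
    · rintro rfl; exact hz ⟨b, rfl⟩

theorem viaEmbeddingHom_formPerm (e : α ↪ β) (l : List α) :
    viaEmbeddingHom e l.formPerm = (l.map e).formPerm := by
  induction l with
  | nil => simp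
  | cons a l ih =>
    cases l with
    | nil => simp
    | cons b l =>
      simp only [List.map_cons, List.formPerm_cons_cons] at ih ⊢
      rw [← ih, map_mul, viaEmbeddingHom_swap]

/-- Conjugating a cycle by `σ` relabels its entries, so the commutator depends only on the values of
`σ` on those entries. With `α = Fin k` it can then be identified by `decide`. -/
theorem formPerm_mul_conj_inv (e : α ↪ β) {σ : Perm β} {s : α → α} {l : List α}
    (hs : ∀ i ∈ l, σ (e i) = e (s i)) :
    σ * ((l.map e).formPerm * σ * (l.map e).formPerm⁻¹)⁻¹ =
      viaEmbeddingHom e ((l.map s).formPerm * l.formPerm⁻¹) := by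
  have h : (l.map e).map σ = (l.map s).map e := by
    simp only [List.map_map]
    exact List.map_congr_left hs
  rw [map_mul, map_inv, viaEmbeddingHom_formPerm, viaEmbeddingHom_formPerm, ← h,
    ← mul_formPerm_mul_inv]
  group

theorem formPerm_mem_alternatingGroup [Fintype α] {l : List α} (hl : l.Nodup)
    (hodd : Odd l.length) : l.formPerm ∈ alternatingGroup α := by
  rcases Nat.lt_or_ge l.length 2 with h | h
  · rw [(List.formPerm_eq_one_iff l hl).2 (by omega)]
    exact one_mem _
  · rw [mem_alternatingGroup, (List.isCycle_formPerm hl h).sign,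
      List.support_formPerm_of_nodup l hl (by rintro x rfl; simp at h),
      List.toFinset_card_of_nodup hl, hodd.neg_one_pow, neg_neg]

/-- Two cycles meeting in one letter multiply to one long cycle; this is how cycles are lengthened.
-/
theorem formPerm_append_mul_formPerm_cons (l l' : List α) (a : α) :
    (l ++ [a]).formPerm * (a :: l').formPerm = (l ++ a :: l').formPerm := by
  induction l with
  | nil => simp
  | cons b l ih =>
    cases l with
    | nil => simp [List.formPerm_cons_cons]
    | cons c l =>
      simp only [List.cons_append, List.formPerm_cons_cons] at ih ⊢
      rw [← ih, mul_assoc]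

theorem MemConjClosure.commutator_formPerm [Fintype β] (e : α ↪ β) {σ : Perm β} {s : α → α}
    {l : List α} (hs : ∀ i ∈ l, σ (e i) = e (s i)) (hl : l.Nodup) (hodd : Odd l.length)
    {x : Perm β} {m : ℕ} (hσ : MemConjClosure (alternatingGroup β) x m σ) :
    MemConjClosure (alternatingGroup β) x (2 * m)
      (viaEmbeddingHom e ((l.map s).formPerm * l.formPerm⁻¹)) := by
  rw [← formPerm_mul_conj_inv e hs]
  exact hσ.mul_conj_inv
    (formPerm_mem_alternatingGroup (hl.map e.injective) (by simpa using hodd))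

end Transport

theorem viaEmbeddingHom_apply_eq {α β : Type*} (e : α ↪ β) {t : Perm α} {i j : α}
    (h : t i = j) : viaEmbeddingHom e t (e i) = e j := by
  rw [viaEmbeddingHom_apply, viaEmbedding_apply, h]

/-! ### Building long cycles -/

section Cycles

variable {α : Type*} [Fintype α] [DecidableEq α]

theorem cycleType_formPerm_of_nodup {l : List α} (hl : l.Nodup) (h2 : 2 ≤ l.length) :
    l.formPerm.cycleType = {l.length} := by
  rw [(List.isCycle_formPerm hl h2).cycleType,
    List.support_formPerm_of_nodup l hl (by rintro x rfl; simp at h2),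
    List.toFinset_card_of_nodup hl]

theorem exists_alternatingGroup_conj_formPerm {l l' : List α} (hl : l.Nodup) (hl' : l'.Nodup)
    (hlen : l'.length = l.length) (h2 : 2 ≤ l.length) (hodd : Odd l.length)
    (hcard : l.length + 2 ≤ Fintype.card α) :
    ∃ g ∈ alternatingGroup α, g * l.formPerm * g⁻¹ = l'.formPerm := by
  have hc : IsConj l.formPerm l'.formPerm := by
    rw [isConj_iff_cycleType_eq, cycleType_formPerm_of_nodup hl h2,
      cycleType_formPerm_of_nodup hl' (hlen ▸ h2), hlen]
  have h := alternatingGroup.isConj_of (σ := ⟨_, formPerm_mem_alternatingGroup hl hodd⟩)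
    (τ := ⟨_, formPerm_mem_alternatingGroup hl' (hlen ▸ hodd)⟩) hc (by
      rwa [List.support_formPerm_of_nodup l hl (by rintro x rfl; simp at h2),
        List.toFinset_card_of_nodup hl])
  obtain ⟨g, hg⟩ := isConj_iff.1 h
  exact ⟨g, g.2, congrArg Subtype.val hg⟩

/-- Some cycle of length `r` lies in the subgroup generated by `m` conjugates of `x` by even
permutations. -/
def HasCycleInConjClosure (x : Perm α) (r m : ℕ) : Prop :=
  ∃ l : List α, l.Nodup ∧ l.length = r ∧ MemConjClosure (alternatingGroup α) x m l.formPerm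

namespace HasCycleInConjClosure

variable {x : Perm α} {k m r t : ℕ}

theorem mono (h : HasCycleInConjClosure x r k) (hkm : k ≤ m) : HasCycleInConjClosure x r m := by
  obtain ⟨l, hl, hlen, h⟩ := h
  exact ⟨l, hl, hlen, h.mono hkm⟩

theorem memConjClosure (h : HasCycleInConjClosure x r m) (h2 : 2 ≤ r) (hodd : Odd r)
    (hcard : r + 2 ≤ Fintype.card α) {l : List α} (hl : l.Nodup) (hlen : l.length = r) :
    MemConjClosure (alternatingGroup α) x m l.formPerm := by
  obtain ⟨l', hl', rfl, h⟩ := h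
  obtain ⟨g, hg, e⟩ := exists_alternatingGroup_conj_formPerm hl' hl hlen h2 hodd hcard
  exact e ▸ h.conj hg

theorem exists_list_disjoint (l : List α) (h : l.length + t ≤ Fintype.card α) :
    ∃ d : List α, d.Nodup ∧ d.length = t ∧ d.Disjoint l := by
  have h1 : t ≤ (l.toFinset)ᶜ.card := by
    rw [Finset.card_compl]
    have := List.toFinset_card_le l
    omega
  obtain ⟨s, hs, hst⟩ := Finset.exists_subset_card_eq h1
  refine ⟨s.toList, s.nodup_toList, by simpa using hst, fun a ha hal => ?_⟩
  have := hs (Finset.mem_toList.1 ha)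
  simp [hal] at this

/-- The second cycle may be moved so that it meets the first in exactly its last letter. The two
spare letters in `hcard` make cycles of length `t + 1` conjugate by even permutations. -/
theorem extend (h : HasCycleInConjClosure x r m) (hr : r ≠ 0)
    (h' : HasCycleInConjClosure x (t + 1) k) (ht : t ≠ 0) (hodd : Odd (t + 1))
    (hcard : t + 3 ≤ Fintype.card α) (hrt : r + t ≤ Fintype.card α) :
    HasCycleInConjClosure x (r + t) (m + k) := by
  obtain ⟨l, hl, rfl, h⟩ := h
  obtain ⟨d, hd, rfl, hdl⟩ := exists_list_disjoint l hrt
  obtain ⟨l, a, rfl⟩ : ∃ l' a, l = l' ++ [a] := by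
    rcases l.eq_nil_or_concat with rfl | ⟨l', a, rfl⟩
    · simp at hr
    · exact ⟨l', a, by simp⟩
  have had : (a :: d).Nodup := List.nodup_cons.2 ⟨fun ha => hdl ha (by simp), hd⟩
  refine ⟨l ++ a :: d, ?_, by simp; omega, ?_⟩
  · have := (List.nodup_append.2 ⟨hl, hd, fun b hb c hc => by rintro rfl; exact hdl hc hb⟩)
    simpa using this
  · rw [← formPerm_append_mul_formPerm_cons]
    exact h.mul (h'.memConjClosure (by omega) hodd (by omega) had (by simp))

theorem one [Nonempty α] (x : Perm α) : HasCycleInConjClosure x 1 0 :=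
  ⟨[Classical.arbitrary α], by simp, rfl, by simpa using MemConjClosure.one _ x 0⟩

theorem of_three [Nonempty α] (h : HasCycleInConjClosure x 3 2) (hcard : 5 ≤ Fintype.card α)
    (hodd : Odd r) (hr : r ≤ Fintype.card α) : HasCycleInConjClosure x r (r - 1) := by
  obtain ⟨j, rfl⟩ := hodd
  induction j with
  | zero => exact one x
  | succ j ih =>
    refine ((ih (by omega)).extend (t := 2) (by omega) h (by omega) (by decide) hcard
      (by omega)).mono (by omega)

/-- Gluing on a 5-cycle adds four to both length and cost, so the lengths 5 and 7 start the two
residue classes of odd numbers modulo 4. -/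
theorem of_five_seven (h5 : HasCycleInConjClosure x 5 4)
    (h7 : 7 ≤ Fintype.card α → HasCycleInConjClosure x 7 6) (h : 5 ≤ r) (hodd : Odd r)
    (hr : r ≤ Fintype.card α) : HasCycleInConjClosure x r (r - 1) := by
  induction r using Nat.strong_induction_on with
  | _ r ih =>
    rcases Nat.lt_or_ge r 9 with h9 | h9
    · obtain ⟨j, rfl⟩ := hodd
      obtain rfl | rfl : j = 2 ∨ j = 3 := by omega
      · exact h5
      · exact h7 hr
    · obtain ⟨q, rfl⟩ := Nat.exists_eq_add_of_le' (show 4 ≤ r by omega)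
      refine ((ih q (by omega) (by omega) ?_ (by omega)).extend (t := 4) (by omega) h5
        (by omega) (by decide) (by omega) hr).mono (by omega)
      rcases hodd with ⟨j, hj⟩
      exact ⟨j - 2, by omega⟩

end HasCycleInConjClosure

/-- The embedding of `Fin l.length` which lists the entries of a list without repetitions. -/
def listEmbedding {β : Type*} {l : List β} (h : l.Nodup) : Fin l.length ↪ β :=
  ⟨l.get, List.nodup_iff_injective_get.1 h⟩

namespace MemConjClosure

variable {x σ : Perm α} {m : ℕ}

theorem hasCycle_of_eq {k : ℕ} {e : Fin k ↪ α} {t : Perm (Fin k)}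
    (h : MemConjClosure (alternatingGroup α) x m (viaEmbeddingHom e t)) (l : List (Fin k))
    (hl : l.Nodup) (ht : t = l.formPerm) : HasCycleInConjClosure x l.length m :=
  ⟨l.map e, hl.map e.injective, by simp, by rwa [← viaEmbeddingHom_formPerm, ← ht]⟩

/-- A permutation with a cycle of length at least four has a commutator with an even permutation
which is a 3-cycle. -/
theorem hasCycle_three_of_four_points (h : MemConjClosure (alternatingGroup α) x m σ)
    (e : Fin 4 ↪ α) (h0 : σ (e 0) = e 1) (h1 : σ (e 1) = e 2) (h2 : σ (e 2) = e 3) :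
    HasCycleInConjClosure x 3 (2 * m) :=
  -- Only the values of `s` on `l` are used; the last entry is a dummy, as `σ (e 3)` is unknown.
  (h.commutator_formPerm e (s := ![1, 2, 3, 0]) (l := [0, 1, 2]) (by simp [h0, h1, h2])
    (by decide) (by decide)).hasCycle_of_eq [0, 3, 1] (by decide) (by decide)

theorem hasCycle_three_of_fixed_point (h : MemConjClosure (alternatingGroup α) x m σ)
    (e : Fin 3 ↪ α) (h0 : σ (e 0) = e 1) (h1 : σ (e 1) = e 0) (h2 : σ (e 2) = e 2) :
    HasCycleInConjClosure x 3 (2 * m) :=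
  (h.commutator_formPerm e (s := ![1, 0, 2]) (l := [0, 1, 2]) (by simp [h0, h1, h2])
    (by decide) (by decide)).hasCycle_of_eq [0, 1, 2] (by decide) (by decide)

theorem hasCycle_five_of_two_three_cycles (h : MemConjClosure (alternatingGroup α) x m σ)
    (e : Fin 6 ↪ α) (h0 : σ (e 0) = e 1) (h1 : σ (e 1) = e 2) (h3 : σ (e 3) = e 4) :
    HasCycleInConjClosure x 5 (2 * m) :=
  (h.commutator_formPerm e (s := ![1, 2, 0, 4, 5, 3]) (l := [0, 1, 3]) (by simp [h0, h1, h3])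
    (by decide) (by decide)).hasCycle_of_eq [0, 3, 2, 4, 1] (by decide) (by decide)

end MemConjClosure

theorem HasCycleInConjClosure.three_of_five {x : Perm α} {m : ℕ}
    (h : HasCycleInConjClosure x 5 m) : HasCycleInConjClosure x 3 (2 * m) := by
  obtain ⟨l, hl, hlen, h⟩ := h
  obtain ⟨a, b, c, d, e, rfl⟩ : ∃ a b c d e, l = [a, b, c, d, e] := by
    match l, hlen with
    | [a, b, c, d, e], _ => exact ⟨a, b, c, d, e, rfl⟩
  have hval : ∀ i (hi : i + 1 < 5), (List.formPerm [a, b, c, d, e]) ([a, b, c, d, e][i]'(by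
      simp only [List.length_cons, List.length_nil]; omega)) = [a, b, c, d, e][i + 1] :=
    fun i hi => List.formPerm_apply_lt_getElem _ hl i hi
  have hnd : [a, b, c, d].Nodup := List.Nodup.of_append_left (l₂ := [e]) hl
  exact h.hasCycle_three_of_four_points (listEmbedding hnd) (hval 0 (by omega))
    (hval 1 (by omega)) (hval 2 (by omega))

/-! ### The upper bound for permutations of prime order -/

section PrimeOrder

variable {σ : Perm α}

theorem hasCycle_three_of_prime_ge_five {p : ℕ} (hp : p.Prime) (h5 : 5 ≤ p) (hσ : orderOf σ = p) :
    HasCycleInConjClosure σ 3 2 := by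
  have hne : σ ≠ 1 := by
    rintro rfl
    rw [orderOf_one] at hσ
    omega
  obtain ⟨a, ha⟩ : ∃ a, σ a ≠ a := by
    by_contra! h
    exact hne (Equiv.ext h)
  -- A period `d < p` is coprime to `p`, which would make `a` a fixed point; so the first four
  -- iterates are distinct.
  have hper : ∀ d, 0 < d → d < 4 → (σ ^ d) a ≠ a := fun d hd hd4 h => by
    have h1 : Function.IsPeriodicPt σ d a := by
      rw [Function.IsPeriodicPt, ← Perm.coe_pow]; exact h
    have h2 : Function.IsPeriodicPt σ p a := by
      rw [Function.IsPeriodicPt, ← Perm.coe_pow, ← hσ, pow_orderOf_eq_one]; rfl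
    have h3 := h1.gcd h2
    rw [Nat.Coprime.gcd_eq_one
      ((Nat.coprime_of_lt_prime hd.ne' (by omega) hp)).symm] at h3
    exact ha h3
  have p1 := hper 1 (by omega) (by omega)
  have p2 := hper 2 (by omega) (by omega)
  have p3 := hper 3 (by omega) (by omega)
  simp only [pow_succ, pow_zero, one_mul, Perm.mul_apply] at p1 p2 p3
  have hnd : [a, σ a, σ (σ a), σ (σ (σ a))].Nodup := by
    simp only [List.nodup_cons, List.mem_cons, List.not_mem_nil, or_false, not_or,
      EmbeddingLike.apply_eq_iff_eq]
    grind
  exact (MemConjClosure.self _ σ).hasCycle_three_of_four_points (listEmbedding hnd) rfl rfl rfl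

theorem hasCycle_three_of_involution_of_fixed_point (hσ : ∀ z, σ (σ z) = z) {a f : α}
    (ha : σ a ≠ a) (hf : σ f = f) : HasCycleInConjClosure σ 3 2 := by
  have hnd : [a, σ a, f].Nodup := by grind
  exact (MemConjClosure.self _ σ).hasCycle_three_of_fixed_point (listEmbedding hnd) rfl (hσ a) hf

theorem isThreeCycle_or_exists_of_pow_three (hσ : ∀ z, σ (σ (σ z)) = z) {a : α} (ha : σ a ≠ a) :
    ([a, σ a, σ (σ a)].Nodup ∧ σ = List.formPerm [a, σ a, σ (σ a)]) ∨
      ∃ b, σ b ≠ b ∧ [a, σ a, σ (σ a), b, σ b, σ (σ b)].Nodup := by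
  have hinj : ∀ y z, σ y = σ z → y = z := fun y z h => σ.injective h
  have hnd : [a, σ a, σ (σ a)].Nodup := by grind
  by_cases h : ∃ b, σ b ≠ b ∧ b ∉ [a, σ a, σ (σ a)]
  · obtain ⟨b, hb, hab⟩ := h
    refine Or.inr ⟨b, hb, ?_⟩
    grind
  · refine Or.inl ⟨hnd, ?_⟩
    push Not at h
    ext1 z
    have hval : ∀ i (hi : i + 1 < 3), (List.formPerm [a, σ a, σ (σ a)]) ([a, σ a, σ (σ a)][i]'(by
        simp only [List.length_cons, List.length_nil]; omega)) = [a, σ a, σ (σ a)][i + 1] :=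
      fun i hi => List.formPerm_apply_lt_getElem _ hnd i hi
    by_cases hz : z ∈ [a, σ a, σ (σ a)]
    · simp only [List.mem_cons, List.not_mem_nil, or_false] at hz
      rcases hz with rfl | rfl | rfl
      · exact (hval 0 (by omega)).symm
      · exact (hval 1 (by omega)).symm
      · rw [hσ]
        exact (List.formPerm_apply_getLast a [σ a, σ (σ a)]).symm
    · rw [List.formPerm_apply_of_notMem hz]
      by_contra hne
      exact hz (h z hne)

theorem hasCycle_of_pow_three (hσ : ∀ z, σ (σ (σ z)) = z) (hne : σ ≠ 1)
    (hcard : 5 ≤ Fintype.card α) {r : ℕ} (h5 : 5 ≤ r) (hodd : Odd r) (hr : r ≤ Fintype.card α) :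
    HasCycleInConjClosure σ r (r - 1) := by
  obtain ⟨a, ha⟩ : ∃ a, σ a ≠ a := by
    by_contra! h
    exact hne (Equiv.ext h)
  have : Nonempty α := ⟨a⟩
  rcases isThreeCycle_or_exists_of_pow_three hσ ha with ⟨hnd, he⟩ | ⟨b, -, hnd⟩
  · refine HasCycleInConjClosure.of_three ?_ hcard hodd hr
    exact ⟨_, hnd, rfl, he ▸ (MemConjClosure.self _ σ).mono (by omega)⟩
  -- The 5-cycle costs only 2, which leaves 4 for the 3-cycle that extends it to length 7.
  · have hc5 : HasCycleInConjClosure σ 5 2 :=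
      (MemConjClosure.self _ σ).hasCycle_five_of_two_three_cycles (listEmbedding hnd) rfl rfl rfl
    refine HasCycleInConjClosure.of_five_seven (hc5.mono (by omega)) (fun h7 => ?_) h5 hodd hr
    exact hc5.extend (t := 2) (by omega) hc5.three_of_five (by omega) (by decide) hcard h7

theorem exists_notMem_of_length_lt (l : List α) (h : l.length < Fintype.card α) :
    ∃ a, a ∉ l := by
  by_contra! hall
  have h1 : Finset.univ ⊆ l.toFinset := fun a _ => List.mem_toFinset.2 (hall a)
  have := (Finset.card_le_card h1).trans (List.toFinset_card_le l)
  rw [Finset.card_univ] at this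
  omega

theorem exists_three_pairs (hσ : ∀ z, σ (σ z) = z) (hfix : ∀ z, σ z ≠ z)
    (hcard : 5 ≤ Fintype.card α) : ∃ a b c, [a, σ a, b, σ b, c, σ c].Nodup := by
  obtain ⟨a, -⟩ := exists_notMem_of_length_lt ([] : List α) (by simp; omega)
  obtain ⟨b, hb⟩ := exists_notMem_of_length_lt [a, σ a] (by simp; omega)
  obtain ⟨c, hc⟩ := exists_notMem_of_length_lt [a, σ a, b, σ b] (by simp; omega)
  refine ⟨a, b, c, ?_⟩
  grind

theorem memConjClosure_two_three_cycles (e : Fin 6 ↪ α) (h0 : σ (e 0) = e 1)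
    (h2 : σ (e 2) = e 3) (h4 : σ (e 4) = e 5) :
    MemConjClosure (alternatingGroup α) σ 2
      (viaEmbeddingHom e (List.formPerm [1, 3, 5] * (List.formPerm [0, 2, 4])⁻¹)) :=
  (MemConjClosure.self _ σ).commutator_formPerm e (s := ![1, 0, 3, 2, 5, 4]) (l := [0, 2, 4])
    (by simp [h0, h2, h4]) (by decide) (by decide)

/-- A pair of 3-cycles (`t3`, cost 2) is joined into a 7-cycle by a 3-cycle of cost 4. The latter is
a commutator of `t4`, itself a commutator of `σ`, which carries `2 → 0 → 6 → 4`. -/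
theorem hasCycle_seven_of_eight_points (hcard : 5 ≤ Fintype.card α) (e : Fin 8 ↪ α)
    (h0 : σ (e 0) = e 1) (h1 : σ (e 1) = e 0) (h2 : σ (e 2) = e 3) (h4 : σ (e 4) = e 5)
    (h6 : σ (e 6) = e 7) : HasCycleInConjClosure σ 7 6 := by
  have t3 : MemConjClosure (alternatingGroup α) σ 2
      (viaEmbeddingHom e (List.formPerm [1, 3, 5] * (List.formPerm [0, 2, 4])⁻¹)) :=
    (MemConjClosure.self _ σ).commutator_formPerm e (s := ![1, 0, 3, 2, 5, 4, 7, 6])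
      (l := [0, 2, 4]) (by simp [h0, h2, h4]) (by decide) (by decide)
  have t4 : MemConjClosure (alternatingGroup α) σ 2
      (viaEmbeddingHom e (List.formPerm [3, 5, 7, 1, 0] * (List.formPerm [2, 4, 6, 0, 1])⁻¹)) :=
    (MemConjClosure.self _ σ).commutator_formPerm e (s := ![1, 0, 3, 2, 5, 4, 7, 6])
      (l := [2, 4, 6, 0, 1]) (by simp [h0, h1, h2, h4, h6]) (by decide) (by decide)
  have hnd : ([2, 0, 6, 4] : List (Fin 8)).Nodup := by decide
  have c3 : HasCycleInConjClosure σ 3 (2 * 2) :=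
    t4.hasCycle_three_of_four_points ((listEmbedding hnd).trans e)
      (viaEmbeddingHom_apply_eq e (i := 2) (j := 0) (by decide))
      (viaEmbeddingHom_apply_eq e (i := 0) (j := 6) (by decide))
      (viaEmbeddingHom_apply_eq e (i := 6) (j := 4) (by decide))
  have c : MemConjClosure (alternatingGroup α) σ 4
      (viaEmbeddingHom e (List.formPerm [0, 1, 6])) := by
    rw [viaEmbeddingHom_formPerm]
    exact c3.memConjClosure (by omega) (by decide) hcard
      ((by decide : ([0, 1, 6] : List (Fin 8)).Nodup).map e.injective) (by simp)
  have t7 := t3.mul c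
  rw [← map_mul] at t7
  exact t7.hasCycle_of_eq [0, 3, 5, 1, 6, 4, 2] (by decide) (by decide)

theorem hasCycle_of_fixedPointFree_involution (hσ : ∀ z, σ (σ z) = z) (hfix : ∀ z, σ z ≠ z)
    (hcard : 5 ≤ Fintype.card α) {r : ℕ} (h5 : 5 ≤ r) (hodd : Odd r) (hr : r ≤ Fintype.card α) :
    HasCycleInConjClosure σ r (r - 1) := by
  obtain ⟨a, b, c, hnd⟩ := exists_three_pairs hσ hfix hcard
  have t3 := memConjClosure_two_three_cycles (listEmbedding hnd) rfl rfl rfl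
  have hnd' : ([1, 3, 5, 4, 2, 0] : List (Fin 6)).Nodup := by decide
  have c5 : HasCycleInConjClosure σ 5 4 :=
    t3.hasCycle_five_of_two_three_cycles ((listEmbedding hnd').trans (listEmbedding hnd))
      (viaEmbeddingHom_apply_eq _ (i := 1) (j := 3) (by decide))
      (viaEmbeddingHom_apply_eq _ (i := 3) (j := 5) (by decide))
      (viaEmbeddingHom_apply_eq _ (i := 4) (j := 2) (by decide))
  refine HasCycleInConjClosure.of_five_seven c5 (fun h7 => ?_) h5 hodd hr
  -- Without fixed points, a seventh letter brings its partner, hence an eighth.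
  obtain ⟨d, hd⟩ := exists_notMem_of_length_lt [a, σ a, b, σ b, c, σ c] h7
  have hd' : σ d ∉ [a, σ a, b, σ b, c, σ c] := by
    simp only [List.mem_cons, List.not_mem_nil, or_false, not_or] at hd ⊢
    grind
  have hnd8 : [d, σ d, a, σ a, b, σ b, c, σ c].Nodup := by
    refine List.nodup_cons.2 ⟨?_, List.nodup_cons.2 ⟨hd', hnd⟩⟩
    rw [List.mem_cons, not_or]
    exact ⟨(hfix d).symm, hd⟩
  exact hasCycle_seven_of_eight_points hcard (listEmbedding hnd8) rfl (hσ d) rfl rfl rfl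

theorem memConjClosure_three_of_fixedPointFree_involution (hσ : ∀ z, σ (σ z) = z)
    (hfix : ∀ z, σ z ≠ z) (hcard : 5 ≤ Fintype.card α) :
    ∃ t, t ^ 3 = 1 ∧ t ≠ 1 ∧ MemConjClosure (alternatingGroup α) σ 2 t := by
  obtain ⟨a, b, c, hnd⟩ := exists_three_pairs hσ hfix hcard
  refine ⟨_, ?_, ?_, memConjClosure_two_three_cycles (listEmbedding hnd) rfl rfl rfl⟩
  · rw [← map_pow, (by decide : (List.formPerm [1, 3, 5] * (List.formPerm [0, 2, 4])⁻¹ :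
      Perm (Fin 6)) ^ 3 = 1), map_one]
  · rw [Ne, map_eq_one_iff _ (viaEmbeddingHom_injective _)]
    decide

/-- The `r - 1` conjugates of a permutation of prime order which generate a subgroup of order
divisible by `r`. -/
theorem exists_memConjClosure_of_prime_orderOf (hσ : (orderOf σ).Prime)
    (hcard : 5 ≤ Fintype.card α) {r : ℕ} (hr : r.Prime) (hodd : Odd r)
    (hrc : r ≤ Fintype.card α) :
    ∃ t, t ^ r = 1 ∧ t ≠ 1 ∧ MemConjClosure (alternatingGroup α) σ (r - 1) t := by
  have hne : σ ≠ 1 := by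
    rintro rfl
    exact Nat.not_prime_one (orderOf_one (G := Perm α) ▸ hσ)
  have hr3 : 3 ≤ r := by
    rcases hodd with ⟨j, rfl⟩
    rcases j with _ | j
    · exact absurd hr Nat.not_prime_one
    · omega
  obtain ⟨a, ha⟩ : ∃ a, σ a ≠ a := by
    by_contra! h
    exact hne (Equiv.ext h)
  have : Nonempty α := ⟨a⟩
  have key : HasCycleInConjClosure σ r (r - 1) →
      ∃ t, t ^ r = 1 ∧ t ≠ 1 ∧ MemConjClosure (alternatingGroup α) σ (r - 1) t := by
    rintro ⟨l, hl, hlen, h⟩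
    refine ⟨_, ?_, ?_, h⟩
    · rw [← hlen, List.formPerm_pow_length_eq_one_of_nodup l hl]
    · rw [Ne, List.formPerm_eq_one_iff l hl]
      omega
  by_cases hpr : orderOf σ = r
  · exact ⟨σ, hpr ▸ pow_orderOf_eq_one σ, hne, (MemConjClosure.self _ σ).mono (by omega)⟩
  rcases Nat.lt_or_ge (orderOf σ) 5 with h5 | h5
  · have h23 : orderOf σ = 2 ∨ orderOf σ = 3 := by
      have := hσ.two_le
      have : orderOf σ ≠ 4 := fun h => by rw [h] at hσ; exact absurd hσ (by decide)
      omega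
    have hr5 : r ≠ 3 → 5 ≤ r := fun h => by
      rcases hodd with ⟨j, rfl⟩
      omega
    rcases h23 with h2 | h3
    · have hinv : ∀ z, σ (σ z) = z := fun z => by
        rw [← Perm.mul_apply, ← pow_two, ← h2, pow_orderOf_eq_one, Perm.one_apply]
      by_cases hfix : ∃ f, σ f = f
      · obtain ⟨f, hf⟩ := hfix
        exact key (HasCycleInConjClosure.of_three
          (hasCycle_three_of_involution_of_fixed_point hinv ha hf) hcard hodd hrc)
      · push Not at hfix
        rcases eq_or_ne r 3 with rfl | hr'
        -- For `r = 3` any element of order three will do: a commutator of `σ` that is a product of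
        -- two 3-cycles serves, so no single 3-cycle is needed.
        · exact memConjClosure_three_of_fixedPointFree_involution hinv hfix hcard
        · exact key (hasCycle_of_fixedPointFree_involution hinv hfix hcard (hr5 hr') hodd hrc)
    · have hinv : ∀ z, σ (σ (σ z)) = z := fun z => by
        rw [← Perm.mul_apply, ← Perm.mul_apply, mul_assoc, ← pow_three, ← h3, pow_orderOf_eq_one,
          Perm.one_apply]
      exact key (hasCycle_of_pow_three hinv hne hcard (hr5 fun h => hpr (h3.trans h.symm)) hodd hrc)
  · exact key (HasCycleInConjClosure.of_three (hasCycle_three_of_prime_ge_five hσ h5 rfl)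
      hcard hodd hrc)

end PrimeOrder

end Cycles

/-! ### The lower bound for transpositions -/

section SwapLowerBound

variable {α : Type*} [Fintype α] [DecidableEq α]

/-- The map `c` labels classes of letters; each further transposition merges at most two classes,
losing at most one label. -/
theorem exists_invariant_of_isSwap {m : ℕ} (y : Fin m → Perm α) (hy : ∀ i, (y i).IsSwap) :
    ∃ c : α → α, (∀ i a, c (y i a) = c a) ∧
      Fintype.card α ≤ (Finset.univ.image c).card + m := by
  induction m with
  | zero => exact ⟨id, fun i => i.elim0, by simp⟩
  | succ m ih =>
    obtain ⟨c, hc, hcard⟩ := ih (fun i => y i.castSucc) (fun i => hy _)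
    obtain ⟨a, b, -, hab⟩ := hy (Fin.last m)
    refine ⟨fun z => if c z = c b then c a else c z, fun i z => ?_, ?_⟩
    · induction i using Fin.lastCases with
      | last => simp only [hab, swap_apply_def]; grind
      | cast i => simp only [hc]
    · have hsub : Finset.univ.image c ⊆
          insert (c b) (Finset.univ.image fun z => if c z = c b then c a else c z) := by
        intro w hw
        obtain ⟨z, -, rfl⟩ := Finset.mem_image.1 hw
        by_cases hz : c z = c b
        · simp [hz]
        · exact Finset.mem_insert_of_mem (Finset.mem_image.2 ⟨z, Finset.mem_univ _, by simp [hz]⟩)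
      have := (Finset.card_le_card hsub).trans (Finset.card_insert_le _ _)
      omega

/-- A moved letter has an orbit of exactly `r` letters, on which `c` takes a single value. -/
theorem card_image_add_prime_le {r : ℕ} (hr : r.Prime) {t : Perm α} (h1 : t ^ r = 1)
    (hne : t ≠ 1) {c : α → α} (hc : ∀ a, c (t a) = c a) :
    (Finset.univ.image c).card + r ≤ Fintype.card α + 1 := by
  obtain ⟨a, ha⟩ : ∃ a, t a ≠ a := by
    by_contra! h
    exact hne (Equiv.ext h)
  have hper : Function.minimalPeriod t a = r := by
    have h2 : Function.IsPeriodicPt t r a := by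
      rw [Function.IsPeriodicPt, ← Perm.coe_pow, h1]; rfl
    refine (hr.eq_one_or_self_of_dvd _ h2.minimalPeriod_dvd).resolve_left fun h => ha ?_
    exact Function.minimalPeriod_eq_one_iff_isFixedPt.1 h
  let S := (Finset.range r).image fun i => t^[i] a
  have hS : S.card = r := by
    rw [Finset.card_image_of_injOn, Finset.card_range]
    have := Function.iterate_injOn_Iio_minimalPeriod (f := t) (x := a)
    rw [hper] at this
    intro i hi j hj
    exact this (by simpa using hi) (by simpa using hj)
  have hconst : ∀ i, c (t^[i] a) = c a := fun i => by
    induction i with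
    | zero => rfl
    | succ i ih => rw [Function.iterate_succ_apply', hc, ih]
  have hsub : Finset.univ.image c ⊆ insert (c a) (Sᶜ.image c) := by
    intro w hw
    obtain ⟨z, -, rfl⟩ := Finset.mem_image.1 hw
    by_cases hz : z ∈ S
    · obtain ⟨i, -, rfl⟩ := Finset.mem_image.1 hz
      simp [hconst]
    · exact Finset.mem_insert_of_mem (Finset.mem_image_of_mem _ (Finset.mem_compl.2 hz))
  have h3 := (Finset.card_le_card hsub).trans (Finset.card_insert_le _ _)
  have h4 : (Sᶜ.image c).card ≤ Sᶜ.card := Finset.card_image_le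
  have h5 := S.card_le_univ
  rw [Finset.card_compl] at h4
  omega

theorem prime_le_of_mem_closure_isSwap {r m : ℕ} (hr : r.Prime) {y : Fin m → Perm α}
    (hy : ∀ i, (y i).IsSwap) {t : Perm α} (ht : t ∈ Subgroup.closure (Set.range y))
    (h1 : t ^ r = 1) (hne : t ≠ 1) : r ≤ m + 1 := by
  obtain ⟨c, hc, hcard⟩ := exists_invariant_of_isSwap y hy
  have hct : ∀ a, c (t a) = c a := by
    clear h1 hne
    induction ht using Subgroup.closure_induction with
    | mem x hx => obtain ⟨i, rfl⟩ := hx; exact hc i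
    | one => exact fun _ => rfl
    | mul s t _ _ hs ht => exact fun a => (hs (t a)).trans (ht a)
    | inv s _ hs =>
      intro a
      rw [← hs (s⁻¹ a), ← Perm.mul_apply, mul_inv_cancel, Perm.one_apply]
  have := card_image_add_prime_le hr h1 hne hct
  omega

end SwapLowerBound

theorem sub_one_le_betaNumber_of_isSwap {n r : ℕ} (hn : 4 ≤ n) (hr : r.Prime)
    {σ : Perm (Fin n)} (hσ : σ.IsSwap) :
    ((r - 1 : ℕ) : ℕ∞) ≤ betaNumber r (symmetricToAut n σ) := by
  refine le_iInf₂ fun m ⟨y, hy, hdvd⟩ => ?_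
  choose g hg using hy
  have hinj := symmetricToAut_injective hn
  have hfin : Finite (MulAut (alternatingGroup (Fin n))) :=
    Finite.of_injective (fun f : MulAut (alternatingGroup (Fin n)) =>
      (f : alternatingGroup (Fin n) → alternatingGroup (Fin n))) DFunLike.coe_injective
  have := Fact.mk hr
  obtain ⟨⟨w, hw⟩, hord⟩ := exists_prime_orderOf_dvd_card' r hdvd
  rw [Subgroup.orderOf_mk] at hord
  let z : Fin m → Perm (Fin n) := fun i => g i * σ * (g i : Perm (Fin n))⁻¹
  have hyz : y = symmetricToAut n ∘ z := by
    funext i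
    simp only [hg, Function.comp_apply, z, map_mul, map_inv, symmetricToAut_coe]
  rw [hyz, Set.range_comp, ← MonoidHom.map_closure] at hw
  obtain ⟨t, ht, rfl⟩ := hw
  rw [orderOf_injective _ hinj] at hord
  have hle := prime_le_of_mem_closure_isSwap (r := r) (y := z) hr (fun i => ?_) ht
    (hord ▸ pow_orderOf_eq_one t) (fun h => by
      rw [h, orderOf_one] at hord
      exact hr.one_lt.ne hord)
  · exact_mod_cast Nat.sub_le_of_le_add hle
  · obtain ⟨a, b, hab, rfl⟩ := hσ
    refine ⟨(g i).1 a, (g i).1 b, fun h => hab ((g i).1.injective h), ?_⟩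
    exact (Equiv.swap_apply_apply _ _ _).symm

/-! ### Pairs of 3-cycles and generation of the alternating group -/

section ThreeCycles

variable {α : Type*} [Fintype α] [DecidableEq α]

theorem Equiv.Perm.IsThreeCycle.apply_apply_apply {d : Perm α} (hd : d.IsThreeCycle) (z : α) :
    d (d (d z)) = z := by
  rw [← Perm.mul_apply, ← Perm.mul_apply, mul_assoc, ← pow_three, ← hd.orderOf,
    pow_orderOf_eq_one, Perm.one_apply]

theorem Equiv.Perm.IsThreeCycle.eq_or_eq_or_eq {d : Perm α} (hd : d.IsThreeCycle) {z w : α} (hz : d z ≠ z)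
    (hw : d w ≠ w) : w = z ∨ w = d z ∨ w = d (d z) := by
  have h3 := IsThreeCycle.apply_apply_apply hd z
  have hzz : d (d z) ≠ z := fun h => hz (by rw [h] at h3; exact h3)
  have hsub : ({z, d z, d (d z)} : Finset α) ⊆ d.support := by
    intro v hv
    simp only [Finset.mem_insert, Finset.mem_singleton] at hv
    rcases hv with rfl | rfl | rfl <;> simpa using hz
  have heq := Finset.eq_of_subset_of_card_le hsub (by
    rw [hd.card_support, Finset.card_eq_three.2 ⟨z, d z, d (d z), hz.symm, hzz.symm, by
      simpa using hz.symm, rfl⟩])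
  have : w ∈ d.support := mem_support.2 hw
  rw [← heq] at this
  simpa using this

theorem Equiv.Perm.IsThreeCycle.exists_apply_ne {d : Perm α} (hd : d.IsThreeCycle) : ∃ z, d z ≠ z := by
  have h : d.support.Nonempty := by
    rw [← Finset.card_pos, hd.card_support]; omega
  exact h.imp fun z hz => mem_support.1 hz

theorem Equiv.Perm.IsThreeCycle.eq_formPerm {d : Perm α} (hd : d.IsThreeCycle) {z : α} (hz : d z ≠ z) :
    [z, d z, d (d z)].Nodup ∧ d = List.formPerm [z, d z, d (d z)] := by
  refine (isThreeCycle_or_exists_of_pow_three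
    (IsThreeCycle.apply_apply_apply hd) hz).resolve_right ?_
  rintro ⟨b, hb, hnd⟩
  have := IsThreeCycle.eq_or_eq_or_eq hd hz hb
  grind

/-- Two 3-cycles whose product is an involution agree at a point which they move. -/
theorem exists_common_arc {c d : Perm α} (hc : c.IsThreeCycle) (hd : d.IsThreeCycle)
    (h : (c * d) ^ 2 = 1) (hne : c * d ≠ 1) : ∃ z, c z ≠ z ∧ d z = c z := by
  by_contra! hno
  have hcd : ∀ z, c (d (c (d z))) = z := fun z => by
    simpa [pow_two] using congrArg (fun f : Perm α => f z) h
  -- With no shared arc, `d` moves every letter that `c` moves (`hmove`) and inverts `c` there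
  -- (`hback`), forcing `c * d = 1`.
  have hmove : ∀ z, c z ≠ z → d z ≠ z := by
    intro z hz hdz
    have h1 := hcd z
    rw [hdz] at h1
    have h2 : c (d (c z)) = c (c (c z)) := h1.trans (IsThreeCycle.apply_apply_apply hc z).symm
    exact hno (c z) (by simpa using hz) (c.injective h2)
  have hback : ∀ z, c z ≠ z → d z = c (c z) := by
    intro z hz
    have h1 := IsThreeCycle.eq_or_eq_or_eq hd (hmove z hz) (hmove (c z) (by simpa using hz))
    have h2 := IsThreeCycle.eq_or_eq_or_eq hd (hmove z hz)
      (hmove (c (c z)) (by simpa using hz))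
    have h3 := hno z hz
    have h4 := IsThreeCycle.apply_apply_apply hc z
    have h5 : c (c z) ≠ z := fun h => hz (by rw [h] at h4; exact h4)
    grind
  apply hne
  ext1 z
  rw [Perm.mul_apply, Perm.one_apply]
  by_cases hz : c z = z
  · by_cases hdz : d z = z
    · rw [hdz, hz]
    · obtain ⟨p, hp⟩ := IsThreeCycle.exists_apply_ne hc
      have h1 := IsThreeCycle.eq_or_eq_or_eq hd (hmove p hp) hdz
      have h2 := hback p hp
      have h3 := hback (c (c p)) (by simpa using hp)
      have h4 := IsThreeCycle.apply_apply_apply hc p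
      grind
  · rw [hback z hz, IsThreeCycle.apply_apply_apply hc]

theorem alternatingGroup_le_of_forall_formPerm_mem {p q : α} (hpq : p ≠ q)
    (H : Subgroup (Perm α)) (hH : ∀ j, j ≠ p → j ≠ q → List.formPerm [p, q, j] ∈ H) :
    alternatingGroup α ≤ H := by
  rw [← closure_three_cycles_eq_alternating, Subgroup.closure_le]
  intro d hd
  obtain ⟨z, hz⟩ := IsThreeCycle.exists_apply_ne hd
  obtain ⟨hnd, he⟩ := IsThreeCycle.eq_formPerm hd hz
  -- `P` is stable under rotation, reversal and conjugation by `H`; conjugating the given 3-cycles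
  -- by one another reaches all remaining triples.
  let P : α → α → α → Prop := fun i j k => List.formPerm [i, j, k] ∈ H
  have rot : ∀ i j k, j ≠ i → k ≠ i → k ≠ j → P i j k → P j k i := fun i j k ji ki kj hP => by
    have := List.formPerm_rotate_one [i, j, k] (by simp [ji.symm, ki.symm, kj.symm])
    simp only [List.rotate_cons_succ, List.rotate_zero, List.cons_append, List.nil_append] at this
    simpa only [P, this] using hP
  have rev : ∀ i j k, P i j k → P k j i := fun i j k hP => by
    have := List.formPerm_reverse [i, j, k]
    simp only [List.reverse_cons, List.reverse_nil, List.nil_append, List.cons_append] at this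
    simpa only [P, this, inv_mem_iff] using hP
  have conj : ∀ g ∈ H, ∀ i j k, P i j k → P (g i) (g j) (g k) := fun g hg i j k hP => by
    have := mul_formPerm_mul_inv g [i, j, k]
    simp only [List.map_cons, List.map_nil] at this
    simp only [P, ← this]
    exact mul_mem (mul_mem hg hP) (inv_mem hg)
  have hval : ∀ i, i ≠ p → i ≠ q → List.formPerm [p, q, i] p = q ∧
      List.formPerm [p, q, i] q = i := fun i hp hq => by
    simp [List.formPerm_cons_cons, swap_apply_of_ne_of_ne, hp, hq, hp.symm, hpq]
  have hfix : ∀ i j, j ≠ p → j ≠ q → j ≠ i → List.formPerm [p, q, i] j = j :=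
    fun i j h1 h2 h3 => List.formPerm_apply_of_notMem (by simp [h1, h2, h3])
  have h1 : ∀ i j, i ≠ p → i ≠ q → j ≠ p → j ≠ q → j ≠ i → P q i j := by
    intro i j ip iq jp jq ji
    have := conj _ (hH i ip iq) p q j (hH j jp jq)
    rwa [(hval i ip iq).1, (hval i ip iq).2, hfix i j jp jq ji] at this
  have h2 : ∀ i j k, i ≠ p → i ≠ q → j ≠ p → j ≠ q → k ≠ p → k ≠ q → j ≠ i → k ≠ i → k ≠ j →
      P i j k := by
    intro i j k ip iq jp jq kp kq ji ki kj
    have := conj _ (hH i ip iq) q j k (h1 j k jp jq kp kq kj)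
    rwa [(hval i ip iq).2, hfix i j jp jq ji, hfix i k kp kq ki] at this
  have h3 : ∀ i j, i ≠ p → i ≠ q → j ≠ p → j ≠ q → j ≠ i → P i p j := by
    intro i j ip iq jp jq ji
    have := conj _ (inv_mem (hH i ip iq)) p q j (hH j jp jq)
    have hi : List.formPerm [p, q, i] i = p := List.formPerm_apply_getLast p [q, i]
    rwa [inv_eq_iff_eq.2 hi.symm, inv_eq_iff_eq.2 (hval i ip iq).1.symm,
      inv_eq_iff_eq.2 (hfix i j jp jq ji).symm] at this
  have h4 : ∀ i, i ≠ p → i ≠ q → P p q i := hH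
  have hmain : ∀ i j k, j ≠ i → k ≠ i → k ≠ j → P i j k := by
    clear_value P
    clear conj hval hfix hH he hnd hz hd
    intro i j k ji ki kj
    have hr2 := rot j k i kj ji.symm ki.symm
    have hr3 := rot k i j ki.symm kj.symm ji
    rcases eq_or_ne i p with ip | ip <;> rcases eq_or_ne i q with iq | iq <;>
    rcases eq_or_ne j p with jp | jp <;> rcases eq_or_ne j q with jq | jq <;>
    rcases eq_or_ne k p with kp | kp <;> rcases eq_or_ne k q with kq | kq <;>
    grind
  rw [he]
  simp only [List.nodup_cons, List.mem_cons, List.not_mem_nil, or_false, not_or] at hnd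
  exact hmain _ _ _ (Ne.symm hnd.1.1) (Ne.symm hnd.1.2) (Ne.symm hnd.2.1)

/-- Disjoint 3-cycles commute; otherwise both live on five letters, in a copy of the alternating
group of order 60. -/
theorem mul_pow_sixty_of_isThreeCycle {c d : Perm α} (hc : c.IsThreeCycle) (hd : d.IsThreeCycle)
    (hcard : 5 ≤ Fintype.card α) : (c * d) ^ 60 = 1 := by
  by_cases hdis : c.Disjoint d
  · have h3 : ∀ e : Perm α, e.IsThreeCycle → e ^ 60 = 1 := fun e he => by
      rw [show 60 = 3 * 20 from rfl, pow_mul, ← he.orderOf, pow_orderOf_eq_one, one_pow]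
    rw [hdis.commute.mul_pow, h3 c hc, h3 d hd, one_mul]
  · have h5 : (c.support ∪ d.support).card ≤ 5 := by
      have h := Finset.card_union_add_card_inter c.support d.support
      rw [disjoint_iff_disjoint_support, Finset.disjoint_iff_inter_eq_empty,
        ← Finset.card_eq_zero] at hdis
      have h1 := hc.card_support
      have h2 := hd.card_support
      omega
    obtain ⟨s, hs, hs5⟩ := Finset.exists_superset_card_eq h5 hcard
    let w : alternatingGroup α := ⟨c * d, mul_mem hc.mem_alternatingGroup hd.mem_alternatingGroup⟩
    have hw : w ∈ (alternatingGroup.ofSubtype s).range := by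
      rw [alternatingGroup.mem_range_ofSubtype_iff]
      exact (support_mul_le c d).trans hs
    obtain ⟨v, hv⟩ := hw
    have : Nontrivial s := by
      rw [← Fintype.one_lt_card_iff_nontrivial, Fintype.card_coe]; omega
    have hv60 : v ^ 60 = 1 := by
      have h := card_alternatingGroup (α := s)
      rw [Fintype.card_coe, hs5] at h
      have h60 : Fintype.card (alternatingGroup s) = 60 := h.trans (by decide)
      rw [← h60, pow_card_eq_one]
    have := congrArg (fun u => ((alternatingGroup.ofSubtype s u : alternatingGroup α) : Perm α)) hv60
    simpa [map_pow, hv, w] using this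

end ThreeCycles

/-! ### Automorphisms induced by permutations -/

section Automorphisms

variable {n : ℕ} {x : MulAut (alternatingGroup (Fin n))}

theorem isThreeCycle_apply_of_isThreeCycle_apply (hn : 5 ≤ n) {c d : alternatingGroup (Fin n)}
    (hc : (c : Perm (Fin n)).IsThreeCycle) (hd : (d : Perm (Fin n)).IsThreeCycle)
    (hxc : (x c : Perm (Fin n)).IsThreeCycle) : (x d : Perm (Fin n)).IsThreeCycle := by
  obtain ⟨g, rfl⟩ := isConj_iff.1
    (alternatingGroup.isThreeCycle_isConj (by simpa using hn) hc hd)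
  rw [IsThreeCycle] at hxc ⊢
  simpa [map_mul, map_inv, cycleType_conj] using hxc

theorem formPerm_triple_mul_formPerm_triple {α : Type*} [DecidableEq α] {p q i j : α}
    (h : [p, q, i, j].Nodup) :
    (List.formPerm [p, q, i] * List.formPerm [p, q, j]) ^ 2 = 1 ∧
      List.formPerm [p, q, i] * List.formPerm [p, q, j] ≠ 1 := by
  let e : Fin 4 ↪ α := listEmbedding h
  have h1 := viaEmbeddingHom_formPerm e [0, 1, 2]
  have h2 := viaEmbeddingHom_formPerm e [0, 1, 3]
  have e1 : List.map e [0, 1, 2] = [p, q, i] := rfl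
  have e2 : List.map e [0, 1, 3] = [p, q, j] := rfl
  rw [← e1, ← e2, ← h1, ← h2, ← map_mul, ← map_pow, Ne,
    map_eq_one_iff _ (viaEmbeddingHom_injective _), map_eq_one_iff _ (viaEmbeddingHom_injective _)]
  decide

/-- A family of distinct 3-cycles any two of which agree at a point which they move has a point
at which all of them agree. -/
theorem exists_common_arc_of_family {α ι : Type*} [Fintype α] [DecidableEq α]
    {E : ι → Perm α} (h3 : ∀ j, (E j).IsThreeCycle) (hinj : Function.Injective E)
    (harc : ∀ i j, i ≠ j → ∃ z, E i z ≠ z ∧ E j z = E i z) {u v : ι} (huv : u ≠ v) :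
    ∃ a, E u a ≠ a ∧ ∀ j, E j a = E u a := by
  have hrec : ∀ i j z, E i z ≠ z → E j z = E i z → E i (E i z) = E j (E i z) → i = j :=
    fun i j z hz h1 h2 => hinj (by
      rw [(IsThreeCycle.eq_formPerm (h3 i) hz).2,
        (IsThreeCycle.eq_formPerm (h3 j) (h1 ▸ hz)).2, h1, h2])
  obtain ⟨a, ha, hva⟩ := harc u v huv
  refine ⟨a, ha, fun j => ?_⟩
  rcases eq_or_ne u j with rfl | hju
  · rfl
  rcases eq_or_ne v j with rfl | hjv
  · exact hva
  obtain ⟨z, hz, hz'⟩ := harc u j hju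
  obtain ⟨w, hw, hw'⟩ := harc v j hjv
  -- The third letters of `E u` and `E v` differ. If `E j` missed the arc at `a`, sharing other arcs
  -- with both would give one letter two images or two preimages, or make a 3-cycle move four
  -- letters.
  have hs : E u (E u a) ≠ E v (E u a) := fun h => huv (hrec u v a ha hva h)
  have m1 := IsThreeCycle.eq_or_eq_or_eq (h3 u) ha hz
  have m2 := IsThreeCycle.eq_or_eq_or_eq (h3 v) (hva ▸ ha) hw
  have m3 := IsThreeCycle.eq_or_eq_or_eq (h3 j) (z := z) (w := w) (by grind) (by grind)
  have c1 := IsThreeCycle.apply_apply_apply (h3 u) a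
  have c2 := IsThreeCycle.apply_apply_apply (h3 v) a
  have c3 := IsThreeCycle.apply_apply_apply (h3 j) z
  have c4 := IsThreeCycle.apply_apply_apply (h3 j) w
  have n1 := (IsThreeCycle.eq_formPerm (h3 u) ha).1
  have n2 := (IsThreeCycle.eq_formPerm (h3 v) (hva ▸ ha)).1
  simp only [List.nodup_cons, List.mem_cons, List.not_mem_nil, or_false, not_or] at n1 n2
  generalize E u = eu at *
  generalize E v = ev at *
  generalize E j = ej at *
  clear hrec harc hinj h3 huv hju hjv
  grind

/-- An automorphism of the alternating group which maps 3-cycles to 3-cycles is induced by a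
permutation. -/
theorem mem_range_symmetricToAut_of_isThreeCycle (hn : 5 ≤ n) {c : alternatingGroup (Fin n)}
    (hc : (c : Perm (Fin n)).IsThreeCycle) (hxc : (x c : Perm (Fin n)).IsThreeCycle) :
    x ∈ (symmetricToAut n).range := by
  obtain ⟨l, hl, hlen, -⟩ := HasCycleInConjClosure.exists_list_disjoint (α := Fin n) (t := 4) []
    (by simp; omega)
  obtain ⟨p, q, u, v, rfl⟩ : ∃ p q u v, l = [p, q, u, v] := by
    match l, hlen with
    | [p, q, u, v], _ => exact ⟨p, q, u, v, rfl⟩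
  have hnd := hl
  simp only [List.nodup_cons, List.mem_cons, List.not_mem_nil, or_false, not_or,
    not_false_eq_true, List.nodup_nil, and_true] at hnd
  obtain ⟨⟨hpq, hpu, hpv⟩, ⟨hqu, hqv⟩, huv⟩ := hnd
  have hnd3 : ∀ j, j ≠ p → j ≠ q → [p, q, j].Nodup := fun j jp jq => by
    simp [hpq, jp.symm, jq.symm]
  let ι := {j : Fin n // j ≠ p ∧ j ≠ q}
  let C : ι → alternatingGroup (Fin n) := fun j =>
    ⟨_, (isThreeCycle_formPerm (hnd3 j j.2.1 j.2.2)).mem_alternatingGroup⟩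
  let E : ι → Perm (Fin n) := fun j => x (C j)
  have h3 : ∀ j, (E j).IsThreeCycle := fun j => isThreeCycle_apply_of_isThreeCycle_apply hn hc
    (isThreeCycle_formPerm (hnd3 j j.2.1 j.2.2)) hxc
  have hinj : Function.Injective E := by
    intro i j h
    have h2 : List.formPerm [p, q, i.1] = List.formPerm [p, q, j.1] :=
      congrArg Subtype.val (x.injective (Subtype.ext h))
    have hval : ∀ k : ι, List.formPerm [p, q, k.1] q = k.1 := fun k => by
      simp [List.formPerm_cons_cons, swap_apply_of_ne_of_ne, k.2.1, k.2.2]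
    exact Subtype.ext (by rw [← hval i, h2, hval j])
  -- The product of `(p, q, i)` and `(p, q, j)` is an involution, a property that `x` preserves.
  have harc : ∀ i j, i ≠ j → ∃ z, E i z ≠ z ∧ E j z = E i z := by
    intro i j hij
    obtain ⟨h1, h2⟩ := formPerm_triple_mul_formPerm_triple (p := p) (q := q) (i := i.1) (j := j.1)
      (by simp [hpq, i.2.1.symm, i.2.2.symm, j.2.1.symm, j.2.2.symm, Subtype.val_injective.ne hij])
    have h1' : (C i * C j) ^ 2 = 1 := Subtype.ext h1
    refine exists_common_arc (h3 i) (h3 j) ?_ fun h => h2 ?_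
    · have := congrArg (fun g => (x g : Perm (Fin n))) h1'
      simpa using this
    · have : C i * C j = 1 := x.injective (by rw [map_mul, map_one]; exact Subtype.ext h)
      exact congrArg Subtype.val this
  obtain ⟨a, ha, hE⟩ := exists_common_arc_of_family h3 hinj harc
    (u := ⟨u, Ne.symm hpu, Ne.symm hqu⟩) (v := ⟨v, Ne.symm hpv, Ne.symm hqv⟩)
    (fun h => huv (congrArg Subtype.val h))
  set b := E ⟨u, Ne.symm hpu, Ne.symm hqu⟩ a
  have hform : ∀ j, [a, b, E j b].Nodup ∧ E j = List.formPerm [a, b, E j b] := fun j => by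
    have := IsThreeCycle.eq_formPerm (h3 j) (z := a) (hE j ▸ ha)
    rwa [hE j] at this
  have hne : ∀ j, E j b ≠ a ∧ E j b ≠ b := fun j => by
    have := (hform j).1
    simp only [List.nodup_cons, List.mem_cons, List.not_mem_nil, or_false, not_or] at this
    exact ⟨Ne.symm this.1.2, Ne.symm this.2.1⟩
  -- All the images have the form `(a, b, E j b)`, so the inducing permutation must send `p`, `q`,
  -- `j` to `a`, `b`, `E j b`.
  let f : Fin n → Fin n := fun z => if hp : z = p then a else if hq : z = q then b else
    E ⟨z, hp, hq⟩ b
  have fp : f p = a := by simp [f]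
  have fq : f q = b := by simp [f, Ne.symm hpq]
  have fj : ∀ j : ι, f j = E j b := fun j => by simp [f, j.2.1, j.2.2]
  have hf : Function.Injective f := by
    have hEb : ∀ i j : ι, E i b = E j b → i = j := fun i j h => hinj (by
      rw [(hform i).2, (hform j).2, h])
    intro y z hyz
    by_cases yp : y = p
    · by_cases zp : z = p
      · rw [yp, zp]
      · by_cases zq : z = q
        · rw [yp, zq, fp, fq] at hyz
          exact absurd hyz (Ne.symm ha)
        · rw [yp, fp, fj ⟨z, zp, zq⟩] at hyz
          exact absurd hyz.symm (hne _).1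
    · by_cases yq : y = q
      · by_cases zp : z = p
        · rw [yq, zp, fp, fq] at hyz
          exact absurd hyz ha
        · by_cases zq : z = q
          · rw [yq, zq]
          · rw [yq, fq, fj ⟨z, zp, zq⟩] at hyz
            exact absurd hyz.symm (hne _).2
      · rw [fj ⟨y, yp, yq⟩] at hyz
        by_cases zp : z = p
        · rw [zp, fp] at hyz
          exact absurd hyz (hne _).1
        · by_cases zq : z = q
          · rw [zq, fq] at hyz
            exact absurd hyz (hne _).2
          · rw [fj ⟨z, zp, zq⟩] at hyz
            exact congrArg Subtype.val (hEb _ _ hyz)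
  let π : Perm (Fin n) := Equiv.ofBijective f (Finite.injective_iff_bijective.1 hf)
  refine ⟨π, ?_⟩
  let K := MonoidHom.eqLocus (symmetricToAut n π).toMonoidHom x.toMonoidHom
  have hK : alternatingGroup (Fin n) ≤ K.map (alternatingGroup (Fin n)).subtype := by
    refine alternatingGroup_le_of_forall_formPerm_mem hpq _ fun j jp jq => ?_
    refine ⟨C ⟨j, jp, jq⟩, Subtype.ext ?_, rfl⟩
    change (symmetricToAut n π (C ⟨j, jp, jq⟩) : Perm (Fin n)) = E ⟨j, jp, jq⟩
    rw [coe_symmetricToAut_apply, (hform _).2]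
    change π * List.formPerm [p, q, j] * π⁻¹ = _
    rw [mul_formPerm_mul_inv]
    change List.formPerm [f p, f q, f j] = _
    rw [fp, fq, fj ⟨j, jp, jq⟩]
  ext1 g
  obtain ⟨g', hg', e⟩ := hK g.2
  obtain rfl : g' = g := Subtype.ext e
  exact hg'

theorem pow_sixty_ne_one_of_eq_formPerm {α : Type*} [DecidableEq α] {k : ℕ} (e : Fin k ↪ α)
    {t : Perm (Fin k)} {l : List (Fin k)} (hl : l.Nodup) (hlen : l.length = 7)
    (ht : t = l.formPerm) : (viaEmbeddingHom e t) ^ 60 ≠ 1 := by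
  intro h
  have hinj := viaEmbeddingHom_injective e
  rw [← map_pow, map_eq_one_iff _ hinj, ht] at h
  have h7 : orderOf l.formPerm = 7 := by
    have := Fact.mk (by decide : Nat.Prime 7)
    refine orderOf_eq_prime (hlen ▸ List.formPerm_pow_length_eq_one_of_nodup l hl) ?_
    rw [Ne, List.formPerm_eq_one_iff l hl]
    omega
  have := orderOf_dvd_of_pow_eq_one h
  rw [h7] at this
  omega

/-- A permutation of order three which moves at least six of at least seven letters has a
commutator with an even permutation of order not dividing 60. -/
theorem exists_commutator_pow_sixty_ne_one {α : Type*} [Fintype α] [DecidableEq α]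
    (h7 : 7 ≤ Fintype.card α) {σ : Perm α} (hσ : ∀ z, σ (σ (σ z)) = z) {a b : α}
    (hnd : [a, σ a, σ (σ a), b, σ b, σ (σ b)].Nodup) :
    ∃ g ∈ alternatingGroup α, (σ * (g * σ * g⁻¹)⁻¹) ^ 60 ≠ 1 := by
  obtain ⟨c, hc⟩ := exists_notMem_of_length_lt _
    (show [a, σ a, σ (σ a), b, σ b, σ (σ b)].length < Fintype.card α from h7)
  -- A seventh letter is either fixed or lies in a third 3-cycle; in each case a 5-cycle is chosen
  -- to make the commutator a 7-cycle.
  by_cases hfix : σ c = c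
  · let e : Fin 7 ↪ α := listEmbedding (List.nodup_cons.2 ⟨hc, hnd⟩)
    refine ⟨(List.map e [1, 2, 4, 0, 5]).formPerm, formPerm_mem_alternatingGroup
      (List.Nodup.map e.injective (by decide)) (by rw [List.length_map]; decide), ?_⟩
    rw [formPerm_mul_conj_inv e (s := ![0, 2, 3, 1, 5, 6, 4])]
    · exact pow_sixty_ne_one_of_eq_formPerm e (l := [1, 0, 4, 3, 5, 6, 2]) (by decide) rfl
        (by decide)
    · intro i hi
      fin_cases hi
      exacts [rfl, rfl, rfl, hfix, rfl]
  · have hnd9 : [c, σ c, σ (σ c), a, σ a, σ (σ a), b, σ b, σ (σ b)].Nodup := by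
      have hc' := hc
      simp only [List.mem_cons, List.not_mem_nil, or_false, not_or] at hc
      have hinj : ∀ y z, σ y = σ z → y = z := fun y z h => σ.injective h
      have h1 : σ c ∉ [a, σ a, σ (σ a), b, σ b, σ (σ b)] := by
        simp only [List.mem_cons, List.not_mem_nil, or_false, not_or]
        grind
      have h2 : σ (σ c) ∉ [a, σ a, σ (σ a), b, σ b, σ (σ b)] := by
        simp only [List.mem_cons, List.not_mem_nil, or_false, not_or]
        grind
      refine List.nodup_cons.2 ⟨?_, List.nodup_cons.2 ⟨?_, List.nodup_cons.2 ⟨h2, hnd⟩⟩⟩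
      · rw [List.mem_cons, List.mem_cons, not_or, not_or]
        refine ⟨Ne.symm hfix, fun h => ?_, hc'⟩
        have := hσ c
        grind
      · rw [List.mem_cons, not_or]
        exact ⟨fun h => hfix (hinj _ _ h.symm), h1⟩
    let e : Fin 9 ↪ α := listEmbedding hnd9
    refine ⟨(List.map e [3, 6, 4, 7, 0]).formPerm, formPerm_mem_alternatingGroup
      (List.Nodup.map e.injective (by decide)) (by rw [List.length_map]; decide), ?_⟩
    rw [formPerm_mul_conj_inv e (s := ![1, 2, 0, 4, 5, 3, 7, 8, 6])]
    · exact pow_sixty_ne_one_of_eq_formPerm e (l := [3, 0, 5, 8, 1, 4, 6]) (by decide) rfl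
        (by decide)
    · intro i hi
      fin_cases hi <;> rfl

theorem apply_ne_one_and_pow_three {c : alternatingGroup (Fin n)}
    (hc : (c : Perm (Fin n)).IsThreeCycle) :
    (x c : Perm (Fin n)) ≠ 1 ∧ ∀ z, (x c : Perm (Fin n)) ((x c : Perm (Fin n))
      ((x c : Perm (Fin n)) z)) = z := by
  have h3 : c ^ 3 = 1 := Subtype.ext (by
    rw [Subgroup.coe_pow, ← hc.orderOf, pow_orderOf_eq_one]; rfl)
  refine ⟨fun h => ?_, fun z => ?_⟩
  · have h1 : c = 1 := x.injective (by rw [map_one]; exact Subtype.ext h)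
    rw [h1] at hc
    exact absurd hc.card_support (by simp)
  · have h1 := congrArg (fun g => (x g : Perm (Fin n)) z) h3
    simpa [pow_three] using h1

/-- Were `x c` to move six letters, then `n ≥ 7` and some commutator of `x c` would have order not
dividing 60. Pulled back by `x`, it is a product of two 3-cycles. -/
theorem isThreeCycle_apply (hn : 5 ≤ n) (h6 : n ≠ 6) {c : alternatingGroup (Fin n)}
    (hc : (c : Perm (Fin n)).IsThreeCycle) : (x c : Perm (Fin n)).IsThreeCycle := by
  obtain ⟨hne, h3⟩ := apply_ne_one_and_pow_three (x := x) hc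
  obtain ⟨a, ha⟩ : ∃ a, (x c : Perm (Fin n)) a ≠ a := by
    by_contra! h
    exact hne (Equiv.ext h)
  rcases isThreeCycle_or_exists_of_pow_three h3 ha with ⟨hnd, he⟩ | ⟨b, -, hnd⟩
  · rw [he]
    exact isThreeCycle_formPerm hnd
  · exfalso
    have hle := hnd.length_le_card
    simp only [List.length_cons, List.length_nil, Fintype.card_fin] at hle
    obtain ⟨g, hg, h60⟩ := exists_commutator_pow_sixty_ne_one (by simp; omega) h3 hnd
    obtain ⟨k, hk⟩ := x.surjective ⟨g, hg⟩
    apply h60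
    have hd : ((k : Perm (Fin n)) * c * (k : Perm (Fin n))⁻¹)⁻¹.IsThreeCycle := by
      rw [IsThreeCycle, cycleType_inv, cycleType_conj]
      exact hc
    have h := mul_pow_sixty_of_isThreeCycle hc hd (by simpa using hn)
    have h' : (c * (k * c * k⁻¹)⁻¹) ^ 60 = 1 := Subtype.ext h
    have h1 := congrArg (fun g => (x g : Perm (Fin n))) h'
    simpa [hk, map_mul, map_inv, map_pow] using h1

theorem mem_range_symmetricToAut (hn : 5 ≤ n) (h6 : n ≠ 6)
    (x : MulAut (alternatingGroup (Fin n))) : x ∈ (symmetricToAut n).range := by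
  obtain ⟨l, hl, hlen, -⟩ := HasCycleInConjClosure.exists_list_disjoint (α := Fin n) (t := 3) []
    (by simp; omega)
  obtain ⟨p, q, u, rfl⟩ : ∃ p q u, l = [p, q, u] := by
    match l, hlen with
    | [p, q, u], _ => exact ⟨p, q, u, rfl⟩
  have hc := isThreeCycle_formPerm hl
  exact mem_range_symmetricToAut_of_isThreeCycle hn (c := ⟨_, hc.mem_alternatingGroup⟩) hc
    (isThreeCycle_apply hn h6 hc)

end Automorphisms

/-! ### Pairs of involutions, and the words for six letters -/

theorem MulAut.mul_conj_mul_inv {G : Type*} [Group G] (x : MulAut G) (g : G) :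
    x * MulAut.conj g * x⁻¹ = MulAut.conj (x g) := by
  ext h
  simp [MulAut.conj_apply]

/-- Two involutions generate a subgroup all of whose elements of order three are powers of their
product. -/
theorem exists_zpow_eq_of_mem_closure_pair {G : Type*} [Group G] {a b w : G} (ha : a * a = 1)
    (hb : b * b = 1) (hw : w ∈ Subgroup.closure {a, b}) (h3 : w ^ 3 = 1) (hne : w ≠ 1) :
    (∃ k : ℤ, w = (a * b) ^ k) ∧ a * w * a⁻¹ = w⁻¹ := by
  have ha' : a⁻¹ = a := inv_eq_of_mul_eq_one_left ha
  have hb' : b⁻¹ = b := inv_eq_of_mul_eq_one_left hb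
  have hflip : ∀ k : ℤ, a * (a * b) ^ k * a⁻¹ = (a * b) ^ (-k) := fun k => by
    rw [← conj_zpow, zpow_neg, ← inv_zpow, mul_inv_rev, hb', ha', ← mul_assoc, ha, one_mul]
  have hflip' : ∀ k : ℤ, a * (a * b) ^ k = (a * b) ^ (-k) * a := fun k => by
    rw [← hflip k, inv_mul_cancel_right]
  -- Rotations or reflections; a reflection squares to 1, so it cannot have order three.
  have hmem : ∃ k : ℤ, w = (a * b) ^ k ∨ w = (a * b) ^ k * a := by
    clear h3 hne
    induction hw using Subgroup.closure_induction with
    | mem y hy =>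
      rcases hy with rfl | rfl
      · exact ⟨0, Or.inr (by simp)⟩
      · exact ⟨-1, Or.inr (by rw [zpow_neg_one, mul_inv_rev, inv_mul_cancel_right, hb'])⟩
    | one => exact ⟨0, Or.inl (by simp)⟩
    | mul s t _ _ hs ht =>
      obtain ⟨j, rfl | rfl⟩ := hs <;> obtain ⟨k, rfl | rfl⟩ := ht
      · exact ⟨j + k, Or.inl (zpow_add _ _ _).symm⟩
      · exact ⟨j + k, Or.inr (by rw [zpow_add, mul_assoc])⟩
      · exact ⟨j + -k, Or.inr (by rw [zpow_add, mul_assoc, hflip', mul_assoc])⟩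
      · exact ⟨j + -k, Or.inl (by
          rw [zpow_add, mul_assoc, ← mul_assoc a, hflip', mul_assoc _ a a, ha, mul_one])⟩
    | inv s _ hs =>
      obtain ⟨j, rfl | rfl⟩ := hs
      · exact ⟨-j, Or.inl (zpow_neg _ _).symm⟩
      · exact ⟨j, Or.inr (by rw [mul_inv_rev, ← zpow_neg, ha', hflip', neg_neg])⟩
  obtain ⟨k, rfl | rfl⟩ := hmem
  · exact ⟨⟨k, rfl⟩, by rw [hflip, zpow_neg]⟩
  · exfalso
    apply hne
    have h2 : (a * b) ^ k * a * ((a * b) ^ k * a) = 1 := by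
      rw [mul_assoc, ← mul_assoc a, hflip', mul_assoc _ a a, ha, mul_one, ← zpow_add,
        add_neg_cancel, zpow_zero]
    rwa [pow_succ, pow_two, h2, one_mul] at h3

/-- The product of `u` and `c⁻¹` has order dividing three, or the commutator of `u` and `c` has order
five and a certain word in `u * c⁻¹` and `c⁻¹ * u` has order three. -/
def WordAlternative {G : Type*} [Group G] (u c : G) : Prop :=
  (u * c⁻¹) ^ 3 = 1 ∨
    (u * c * u⁻¹ * c⁻¹) ^ 5 = 1 ∧ u * c * u⁻¹ * c⁻¹ ≠ 1 ∧
    ((c⁻¹ * u) * (u * c⁻¹) ^ 2 * (c⁻¹ * u) ^ 2 * (u * c⁻¹)) ^ 3 = 1 ∧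
    (c⁻¹ * u) * (u * c⁻¹) ^ 2 * (c⁻¹ * u) ^ 2 * (u * c⁻¹) ≠ 1

theorem wordAlternative_map_iff {G H : Type*} [Group G] [Group H] {f : G →* H}
    (hf : Function.Injective f) (u c : G) :
    WordAlternative (f u) (f c) ↔ WordAlternative u c := by
  simp only [WordAlternative, ← map_mul, ← map_inv, ← map_pow, Ne, map_eq_one_iff f hf]

/-! ### Outer automorphisms on six letters -/

section SixLetters

/-- The fixed product of two disjoint 3-cycles on six letters. -/
def doubleThreeCycle : Perm (Fin 6) := List.formPerm [0, 1, 2] * List.formPerm [3, 4, 5]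

theorem exists_even_conj_doubleThreeCycle {v : Perm (Fin 6)} (h1 : v ≠ 1) (h3 : v ^ 3 = 1)
    (hv : ¬ v.IsThreeCycle) : ∃ g ∈ alternatingGroup (Fin 6), v = g * doubleThreeCycle * g⁻¹ := by
  have h3' : ∀ z, v (v (v z)) = z := fun z => by
    simpa [pow_three] using congrArg (fun f : Perm (Fin 6) => f z) h3
  obtain ⟨a, ha⟩ : ∃ a, v a ≠ a := by
    by_contra! h
    exact h1 (Equiv.ext h)
  rcases isThreeCycle_or_exists_of_pow_three h3' ha with ⟨hnd, he⟩ | ⟨b, -, hnd⟩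
  · exact absurd (he ▸ isThreeCycle_formPerm hnd) hv
  · let e : Fin 6 ↪ Fin 6 := listEmbedding hnd
    let π : Perm (Fin 6) :=
      Equiv.ofBijective e (Finite.injective_iff_bijective.1 e.injective)
    have hπ : v * π = π * doubleThreeCycle := by
      ext1 i
      have hd : doubleThreeCycle i = ![1, 2, 0, 4, 5, 3] i := by revert i; decide
      rw [Perm.mul_apply, Perm.mul_apply, hd]
      fin_cases i
      exacts [rfl, rfl, h3' a, rfl, rfl, h3' b]
    have hπ' : v = π * doubleThreeCycle * π⁻¹ := by rw [← hπ, mul_inv_cancel_right]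
    rcases Int.units_eq_one_or (sign π) with hs | hs
    · exact ⟨π, mem_alternatingGroup.2 hs, hπ'⟩
    -- An odd permutation centralizing `doubleThreeCycle`, used to correct the parity of `π`.
    · let τ : Perm (Fin 6) := swap 0 3 * swap 1 4 * swap 2 5
      have hτ : τ * doubleThreeCycle * τ⁻¹ = doubleThreeCycle := by decide
      refine ⟨π * τ, ?_, ?_⟩
      · have hτs : sign τ = -1 := by decide
        rw [mem_alternatingGroup, map_mul, hs, hτs]
        rfl
      · rw [mul_inv_rev, hπ']
        conv_lhs => rw [← hτ]
        group

variable {x : MulAut (alternatingGroup (Fin 6))}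

theorem not_isThreeCycle_apply (hx : x ∉ (symmetricToAut 6).range)
    {c : alternatingGroup (Fin 6)} (hc : (c : Perm (Fin 6)).IsThreeCycle) :
    ¬ (x c : Perm (Fin 6)).IsThreeCycle :=
  fun h => hx (mem_range_symmetricToAut_of_isThreeCycle (by omega) hc h)

/-- The products of two 3-cycles form one class under even permutations. If `x` mapped it to itself,
powers of `x` could never bring `x c`, for a 3-cycle `c`, back to `c`. -/
theorem isThreeCycle_apply_of_not_isThreeCycle (hx : x ∉ (symmetricToAut 6).range)
    (hfin : IsOfFinOrder x) {v : alternatingGroup (Fin 6)} (h1 : v ≠ 1) (h3 : v ^ 3 = 1)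
    (hv : ¬ (v : Perm (Fin 6)).IsThreeCycle) : (x v : Perm (Fin 6)).IsThreeCycle := by
  by_contra hxv
  let D : alternatingGroup (Fin 6) → Prop := fun w =>
    w ≠ 1 ∧ w ^ 3 = 1 ∧ ¬ (w : Perm (Fin 6)).IsThreeCycle
  have hconj : ∀ w, D w → D (x w) := by
    rintro w ⟨hw1, hw3, hw⟩
    refine ⟨by simpa using hw1, by rw [← map_pow, hw3, map_one], ?_⟩
    obtain ⟨g, hg, hgv⟩ := exists_even_conj_doubleThreeCycle (fun h => h1 (Subtype.ext h))
      (congrArg Subtype.val h3) hv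
    obtain ⟨k, hk, hkw⟩ := exists_even_conj_doubleThreeCycle (fun h => hw1 (Subtype.ext h))
      (congrArg Subtype.val hw3) hw
    have hwv : w = ⟨k * g⁻¹, mul_mem hk (inv_mem hg)⟩ * v *
        (⟨k * g⁻¹, mul_mem hk (inv_mem hg)⟩ : alternatingGroup (Fin 6))⁻¹ := by
      apply Subtype.ext
      simp only [Subgroup.coe_mul, Subgroup.coe_inv, hgv, hkw]
      group
    rw [hwv, map_mul, map_mul, map_inv, IsThreeCycle, Subgroup.coe_mul, Subgroup.coe_mul,
      Subgroup.coe_inv, cycleType_conj]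
    exact hxv
  have hpow : ∀ k w, D w → D ((x ^ k) w) := by
    intro k
    induction k with
    | zero => exact fun w hw => by simpa using hw
    | succ k ih =>
      intro w hw
      rw [pow_succ, MulAut.mul_apply]
      exact ih _ (hconj w hw)
  have hc := isThreeCycle_formPerm (by decide : ([0, 1, 2] : List (Fin 6)).Nodup)
  let c : alternatingGroup (Fin 6) := ⟨_, hc.mem_alternatingGroup⟩
  obtain ⟨hne, hx3⟩ := apply_ne_one_and_pow_three (x := x) (c := c) hc
  have hD : D (x c) := by
    refine ⟨fun h => hne (by rw [h]; rfl), Subtype.ext ?_, not_isThreeCycle_apply hx hc⟩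
    ext1 z
    simpa [pow_three] using hx3 z
  have := (hpow (orderOf x - 1) _ hD).2.2
  rw [← MulAut.mul_apply, ← pow_succ, Nat.sub_add_cancel hfin.orderOf_pos,
    pow_orderOf_eq_one] at this
  exact this hc

/-- The square of `x` preserves 3-cycles, so it is induced by a permutation; in odd order `x` is a
power of its square. -/
theorem orderOf_eq_two_of_notMem_range (hx : x ∉ (symmetricToAut 6).range)
    (hp : (orderOf x).Prime) : orderOf x = 2 := by
  refine hp.eq_two_or_odd'.resolve_right fun hodd => hx ?_
  have hc := isThreeCycle_formPerm (by decide : ([0, 1, 2] : List (Fin 6)).Nodup)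
  let c : alternatingGroup (Fin 6) := ⟨_, hc.mem_alternatingGroup⟩
  obtain ⟨hne, h3⟩ := apply_ne_one_and_pow_three (x := x) (c := c) hc
  have hxx : ((x ^ 2) c : Perm (Fin 6)).IsThreeCycle := by
    rw [pow_two, MulAut.mul_apply]
    refine isThreeCycle_apply_of_not_isThreeCycle hx (orderOf_pos_iff.1 hp.pos)
      (fun h => hne (by rw [h]; rfl)) ?_ (not_isThreeCycle_apply hx hc)
    apply Subtype.ext
    ext1 z
    simpa [pow_three] using h3 z
  have h2 := mem_range_symmetricToAut_of_isThreeCycle (by omega) hc hxx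
  obtain ⟨j, hj⟩ := hodd
  have : x = (x ^ 2) ^ (j + 1) := by
    rw [← pow_mul, show 2 * (j + 1) = orderOf x + 1 by omega, pow_succ, pow_orderOf_eq_one,
      one_mul]
  rw [this]
  exact pow_mem h2 _

/-- Inversion keeps the cycle type, whereas `x` exchanges the two classes of elements of order
three. -/
theorem apply_ne_inv_of_pow_three (hx : x ∉ (symmetricToAut 6).range) (hfin : IsOfFinOrder x)
    {v : alternatingGroup (Fin 6)} (h1 : v ≠ 1) (h3 : v ^ 3 = 1) : x v ≠ v⁻¹ := by
  intro h
  by_cases hv : (v : Perm (Fin 6)).IsThreeCycle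
  · refine not_isThreeCycle_apply hx hv ?_
    rw [h, IsThreeCycle, Subgroup.coe_inv, cycleType_inv]
    exact hv
  · have := isThreeCycle_apply_of_not_isThreeCycle hx hfin h1 h3 hv
    rw [h, IsThreeCycle, Subgroup.coe_inv, cycleType_inv] at this
    exact hv this

theorem wordAlternative_doubleThreeCycle (i j k : Fin 6) (hij : i ≠ j) (hik : i ≠ k)
    (hjk : j ≠ k) : WordAlternative doubleThreeCycle (swap i j * swap j k) := by
  revert i j k
  unfold WordAlternative
  decide +kernel

end SixLetters

/-! ### Conjugates of outer involutions on six letters -/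

section OuterInvolutions

variable {x : MulAut (alternatingGroup (Fin 6))}

theorem exists_words_of_notMem_range (hx : x ∉ (symmetricToAut 6).range) (h2 : orderOf x = 2) :
    ∃ c u : alternatingGroup (Fin 6), x c = u ∧ x u = c ∧
      (u * c * u⁻¹ * c⁻¹) ^ 5 = 1 ∧ u * c * u⁻¹ * c⁻¹ ≠ 1 ∧
      ((c⁻¹ * u) * (u * c⁻¹) ^ 2 * (c⁻¹ * u) ^ 2 * (u * c⁻¹)) ^ 3 = 1 ∧
      (c⁻¹ * u) * (u * c⁻¹) ^ 2 * (c⁻¹ * u) ^ 2 * (u * c⁻¹) ≠ 1 := by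
  have hfin : IsOfFinOrder x := orderOf_pos_iff.1 (by omega)
  have hc := isThreeCycle_formPerm (by decide : ([0, 1, 2] : List (Fin 6)).Nodup)
  obtain ⟨c, hc⟩ : ∃ c : alternatingGroup (Fin 6), (c : Perm (Fin 6)).IsThreeCycle :=
    ⟨⟨_, hc.mem_alternatingGroup⟩, hc⟩
  obtain ⟨hne, h3⟩ := apply_ne_one_and_pow_three (x := x) hc
  have hu3 : (x c : Perm (Fin 6)) ^ 3 = 1 := by
    ext1 z
    simpa [pow_three] using h3 z
  have hxx : x (x c) = c := by
    rw [← MulAut.mul_apply, ← pow_two, ← h2, pow_orderOf_eq_one, MulAut.one_apply]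
  have hu := not_isThreeCycle_apply hx hc
  refine ⟨c, x c, rfl, hxx, ?_⟩
  obtain ⟨g, hg, hgu⟩ := exists_even_conj_doubleThreeCycle hne hu3 hu
  have hgc : (g⁻¹ * c * g : Perm (Fin 6)).IsThreeCycle := by
    have := cycleType_conj (σ := (c : Perm (Fin 6))) (τ := g⁻¹)
    rw [inv_inv] at this
    rw [IsThreeCycle, this]
    exact hc
  obtain ⟨z, hz⟩ := IsThreeCycle.exists_apply_ne hgc
  obtain ⟨hnd, he⟩ := IsThreeCycle.eq_formPerm hgc hz
  simp only [List.nodup_cons, List.mem_cons, List.not_mem_nil, or_false, not_or] at hnd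
  have hwords := wordAlternative_doubleThreeCycle _ _ _ hnd.1.1 hnd.1.2 hnd.2.1
  simp only [List.formPerm_cons_cons, List.formPerm_singleton, mul_one] at he
  rw [← he] at hwords
  have hu₀ : g⁻¹ * (x c : Perm (Fin 6)) * g = doubleThreeCycle := by
    rw [hgu]
    group
  have hφ : WordAlternative (x c) c := by
    rw [← wordAlternative_map_iff (alternatingGroup (Fin 6)).subtype_injective,
      ← wordAlternative_map_iff (f := (MulAut.conj g⁻¹).toMonoidHom) (MulEquiv.injective _)]
    simpa [MulAut.conj_apply, hu₀] using hwords
  -- `x` exchanges `c` and `u`, hence inverts `u * c⁻¹`, which therefore cannot have order three.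
  refine hφ.resolve_left fun h => ?_
  refine apply_ne_inv_of_pow_three hx hfin (fun h1 => hu ?_) h ?_
  · rw [mul_inv_eq_one] at h1
    rwa [h1]
  · rw [map_mul, map_inv, hxx, mul_inv_rev, inv_inv]

/-- Two conjugates of an involution multiply to an inner automorphism: `w = c * u` gives the
commutator of `u` and `c`, while `w = c` and `w = u⁻¹` give `u * c⁻¹` and `c⁻¹ * u`. -/
theorem mul_conj_mul_self (h : x * x = 1) (w : alternatingGroup (Fin 6)) :
    x * (MulAut.conj w * x * (MulAut.conj w)⁻¹) = MulAut.conj (x w * w⁻¹) := by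
  have hx : x⁻¹ = x := inv_eq_of_mul_eq_one_left h
  rw [map_mul, ← MulAut.mul_conj_mul_inv, hx, map_inv]
  group

theorem alternatingGroup_conj_eq_one_iff {n : ℕ} (hn : 4 ≤ n) (g : alternatingGroup (Fin n)) :
    MulAut.conj g = 1 ↔ g = 1 := by
  rw [← symmetricToAut_coe, map_eq_one_iff _ (symmetricToAut_injective hn),
    OneMemClass.coe_eq_one]

theorem betaNumber_five_le_two (hx : x ∉ (symmetricToAut 6).range) (h2 : orderOf x = 2) :
    betaNumber 5 x ≤ 2 := by
  obtain ⟨c, u, hxc, hxu, h5, hne, -, -⟩ := exists_words_of_notMem_range hx h2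
  have hxx : x * x = 1 := by rw [← pow_two, ← h2, pow_orderOf_eq_one]
  have h := (MemConjClosure.self (MulAut.conj).range x).mul
    (MemConjClosure.conj_self (x := x) ⟨c * u, rfl⟩)
  rw [mul_conj_mul_self hxx, map_mul x, hxc, hxu, mul_inv_rev, ← mul_assoc] at h
  exact_mod_cast betaNumber_le_of_memConjClosure (by decide) h (by rw [← map_pow, h5, map_one])
    (by rwa [Ne, alternatingGroup_conj_eq_one_iff (by omega)])

theorem betaNumber_three_le_three (hx : x ∉ (symmetricToAut 6).range) (h2 : orderOf x = 2) :
    betaNumber 3 x ≤ 3 := by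
  obtain ⟨c, u, hxc, hxu, -, -, h3, hne⟩ := exists_words_of_notMem_range hx h2
  have hxx : x * x = 1 := by rw [← pow_two, ← h2, pow_orderOf_eq_one]
  have hfin : MemConjClosure (MulAut.conj (G := alternatingGroup (Fin 6))).range x 3
      (MulAut.conj ((c⁻¹ * u) * (u * c⁻¹) ^ 2 * (c⁻¹ * u) ^ 2 * (u * c⁻¹))) := by
    refine ⟨![x, MulAut.conj c * x * (MulAut.conj c)⁻¹,
      MulAut.conj u⁻¹ * x * (MulAut.conj u⁻¹)⁻¹], fun i => ?_, ?_⟩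
    · fin_cases i
      exacts [⟨1, one_mem _, by simp⟩, ⟨_, ⟨c, rfl⟩, rfl⟩, ⟨_, ⟨u⁻¹, rfl⟩, rfl⟩]
    · set y := ![x, MulAut.conj c * x * (MulAut.conj c)⁻¹,
        MulAut.conj u⁻¹ * x * (MulAut.conj u⁻¹)⁻¹] with hy
      have hmem : ∀ i, y i ∈ Subgroup.closure (Set.range y) :=
        fun i => Subgroup.subset_closure ⟨i, rfl⟩
      have ha : MulAut.conj (u * c⁻¹) ∈ Subgroup.closure (Set.range y) := by
        have h := mul_conj_mul_self hxx c
        rw [hxc] at h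
        rw [← h]
        exact mul_mem (hmem 0) (hmem 1)
      have hb : MulAut.conj (c⁻¹ * u) ∈ Subgroup.closure (Set.range y) := by
        have h := mul_conj_mul_self hxx u⁻¹
        rw [map_inv x, hxu, inv_inv] at h
        rw [← h]
        exact mul_mem (hmem 0) (hmem 2)
      simp only [map_mul _ (_ * _) (u * c⁻¹), map_mul _ (_ * _) ((c⁻¹ * u) ^ 2),
        map_mul _ (c⁻¹ * u) ((u * c⁻¹) ^ 2), map_pow]
      exact mul_mem (mul_mem (mul_mem hb (pow_mem ha 2)) (pow_mem hb 2)) ha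
  exact_mod_cast betaNumber_le_of_memConjClosure (by decide) hfin
    (by rw [← map_pow, h3, map_one]) (by rwa [Ne, alternatingGroup_conj_eq_one_iff (by omega)])

theorem three_le_of_generatesOrderDivisible (hx : x ∉ (symmetricToAut 6).range)
    (h2 : orderOf x = 2) {m : ℕ} {y : Fin m → MulAut (alternatingGroup (Fin 6))}
    (hy : GeneratesOrderDivisible 3 x y) : 3 ≤ m := by
  by_contra! hm
  obtain ⟨hy, hdvd⟩ := hy
  have hxx : x * x = 1 := by rw [← pow_two, ← h2, pow_orderOf_eq_one]
  have hx' : x⁻¹ = x := inv_eq_of_mul_eq_one_left hxx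
  obtain ⟨g, h, hgh⟩ : ∃ g h : alternatingGroup (Fin 6),
      Set.range y ⊆ {MulAut.conj g * x * (MulAut.conj g)⁻¹,
        MulAut.conj h * x * (MulAut.conj h)⁻¹} := by
    choose g hg using hy
    interval_cases m
    · exact ⟨1, 1, by rintro _ ⟨i, rfl⟩; exact i.elim0⟩
    · refine ⟨g 0, g 0, ?_⟩
      rintro _ ⟨i, rfl⟩
      fin_cases i
      exact Or.inl (hg 0)
    · refine ⟨g 0, g 1, ?_⟩
      rintro _ ⟨i, rfl⟩
      fin_cases i
      exacts [Or.inl (hg 0), Or.inr (hg 1)]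
  have hfin : Finite (MulAut (alternatingGroup (Fin 6))) :=
    Finite.of_injective (fun f : MulAut (alternatingGroup (Fin 6)) =>
      (f : alternatingGroup (Fin 6) → alternatingGroup (Fin 6))) DFunLike.coe_injective
  obtain ⟨⟨w, hw⟩, hord⟩ := exists_prime_orderOf_dvd_card' 3 hdvd
  rw [Subgroup.orderOf_mk] at hord
  have hw3 : w ^ 3 = 1 := hord ▸ pow_orderOf_eq_one w
  have hw1 : w ≠ 1 := fun h => by rw [h, orderOf_one] at hord; omega
  have hinv : ∀ k : alternatingGroup (Fin 6), MulAut.conj k * x * (MulAut.conj k)⁻¹ *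
      (MulAut.conj k * x * (MulAut.conj k)⁻¹) = 1 := fun k => by
    rw [conj_mul, hxx, mul_one, mul_inv_cancel]
  obtain ⟨⟨k, hk⟩, hflip⟩ := exists_zpow_eq_of_mem_closure_pair (hinv g) (hinv h)
    (Subgroup.closure_mono hgh hw) hw3 hw1
  -- The product of the two conjugates is inner, so its power `w` is conjugation by some `v`. The
  -- conjugate of `x` by `g` inverts `w`, so `x` inverts `g⁻¹ * v * g`.
  have hinner : MulAut.conj g * x * (MulAut.conj g)⁻¹ * (MulAut.conj h * x * (MulAut.conj h)⁻¹) =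
      MulAut.conj (g * x (g⁻¹ * h) * h⁻¹) := by
    rw [map_mul, map_mul, ← MulAut.mul_conj_mul_inv, hx', map_mul, map_inv, map_inv]
    group
  rw [hinner, ← map_zpow] at hk
  generalize (g * x (g⁻¹ * h) * h⁻¹) ^ k = v at hk
  subst hk
  rw [← map_pow, alternatingGroup_conj_eq_one_iff (by omega)] at hw3
  rw [Ne, alternatingGroup_conj_eq_one_iff (by omega)] at hw1
  refine apply_ne_inv_of_pow_three hx (isOfFinOrder_of_finite x) (v := g⁻¹ * v * g) ?_ ?_ ?_
  · intro h
    apply hw1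
    have := congrArg (fun t => g * t * g⁻¹) h
    simpa [mul_assoc] using this
  · have := conj_pow (i := 3) (a := g⁻¹) (b := v)
    rw [inv_inv, hw3] at this
    rw [this]
    group
  · have h1 : MulAut.conj (x (g⁻¹ * v * g)) = MulAut.conj (g⁻¹ * v * g)⁻¹ := by
      rw [← MulAut.mul_conj_mul_inv, map_inv, map_mul, map_mul, map_inv]
      have h2 := congrArg (fun t => (MulAut.conj g)⁻¹ * t * MulAut.conj g) hflip
      simp only [mul_inv_rev, inv_inv, mul_assoc, inv_mul_cancel_left, inv_mul_cancel,
        mul_one] at h2 ⊢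
      exact h2
    have h3 := symmetricToAut_injective (n := 6) (by omega)
      ((symmetricToAut_coe _).trans (h1.trans (symmetricToAut_coe _).symm))
    exact Subtype.ext h3

end OuterInvolutions

theorem proposition2 (n : ℕ) (hn : 5 ≤ n) (r : ℕ) (hr : r.Prime) (hodd : Odd r) (hrn : r ≤ n)
    (x : MulAut (alternatingGroup (Fin n))) (hx : (orderOf x).Prime) :
    (IsTranspositionAut x → betaNumber r x = ((r - 1 : ℕ) : ℕ∞)) ∧
    (r = 3 ∧ n = 6 ∧ IsInvolutionOutsideSymmetric x → betaNumber r x = 3) ∧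
    (¬ IsTranspositionAut x → ¬ (r = 3 ∧ n = 6 ∧ IsInvolutionOutsideSymmetric x) →
      betaNumber r x ≤ ((r - 1 : ℕ) : ℕ∞)) := by
  have hupper : x ∈ (symmetricToAut n).range → betaNumber r x ≤ ((r - 1 : ℕ) : ℕ∞) := by
    rintro ⟨σ, rfl⟩
    rw [orderOf_injective _ (symmetricToAut_injective (by omega))] at hx
    obtain ⟨t, h1, hne, ht⟩ := exists_memConjClosure_of_prime_orderOf hx (by simpa using hn) hr
      hodd (by simpa using hrn)
    exact betaNumber_symmetricToAut_le (by omega) hr ht h1 hne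
  refine ⟨?_, ?_, fun _ hout => ?_⟩
  · rintro ⟨σ, hσ, rfl⟩
    exact le_antisymm (hupper ⟨σ, rfl⟩) (sub_one_le_betaNumber_of_isSwap (by omega) hr hσ)
  · rintro ⟨rfl, rfl, h2, hmem⟩
    refine le_antisymm (betaNumber_three_le_three hmem h2) (le_iInf₂ fun m ⟨y, hy⟩ => ?_)
    exact_mod_cast three_le_of_generatesOrderDivisible hmem h2 hy
  · by_cases hmem : x ∈ (symmetricToAut n).range
    · exact hupper hmem
    obtain rfl : n = 6 := by
      by_contra h6
      exact hmem (mem_range_symmetricToAut hn h6 x)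
    have h2 := orderOf_eq_two_of_notMem_range hmem hx
    have hr3 : r ≠ 3 := fun h => hout ⟨h, rfl, h2, hmem⟩
    obtain rfl : r = 5 := by
      have := hr.two_le
      rcases hodd with ⟨j, rfl⟩
      omega
    exact (betaNumber_five_le_two hmem h2).trans (by norm_num)
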